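/- There are $m_0\in\mathbb N$ and real numbers $0<\beta\le 10^{-10}$ and $0<\gamma_0,\gamma_1\le\frac1{50}$ such that the following holds for all $m\ge m_0$. Let $G$ be a graph on $m+1$ vertices of minimum degree at least $\lfloor\frac{2m}3\rfloor$ which is $\gamma_0$-special, that is, $V(G)$ is the union of three mutually disjoint sets $X_1,X_2,X_3$ such that $\frac m3-3\gamma_0m\le|X_i|\le\frac m3+3\gamma_0m$ for $i=1,2,3$ and there are at most $\gamma_0^{10}|X_1|\cdot|X_2|$ edges between $X_1$ and $X_2$. Let $T$ be a tree with $m$ edges such that no vertex of $T$ is adjacent to more than $\beta m$ leaves of $T$. Let $T^*$ be a $\gamma_1$-nice subtree of $T$ with root $t^*$. That is, $T^*$ is a subtree of $T$ containing $t^*$ such that $|V(T^*)|\le\gamma_1m$, every component of $T-T^*$ is adjacent to $t^*$, and at least one of the following holds: (1) $T^*$ contains at least $\lceil\frac{\gamma_1m}{20}\rceil$ disjoint paths of length $5$ all of whose vertices have degree at most $2$ in $T$; (2) $T^*$ contains at least $\lceil\frac{\gamma_1m}{40}\rceil$ leaves of $T$. Let $L\subseteq V(T^*)\setminus\{t^*\}$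 and $S\subseteq V(G)$ be sets with $|S|\le|L|-\lceil(\frac{\gamma_1}2)^4m\rceil$. Suppose that for every $W\subseteq V(G)\setminus S$ with $|W|\ge\gamma_0m$ we are given an embedding $\varphi_W$ of $T^*-L$ into $G-S$ with $\varphi_W(t^*)\in W$. Then, for at least one such $W$, there is an embedding of $T-L$ into $G-S$ which extends $\varphi_W$. (An embedding of a graph $H$ into a graph $H'$ is an injective map $V(H)\to V(H')$ that maps edges of $H$ to edges of $H'$.) -/

import Mathlib

/-- A graph `G` on `m + 1` vertices is `γ`-special: `V(G)` is the union of three mutually disjoint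
sets `X₁, X₂, X₃` of size between `m/3 - 3γm` and `m/3 + 3γm`, with at most `γ¹⁰|X₁||X₂|` edges
between `X₁` and `X₂`. (As `X₁` and `X₂` are disjoint, `G.interedges X₁ X₂`, the set of pairs
`(x, y) ∈ X₁ × X₂` with `x` adjacent to `y`, has one element for each such edge.) -/
def IsGammaSpecial {V : Type*} [Fintype V] [DecidableEq V] (γ : ℝ) (m : ℕ)
    (G : SimpleGraph V) [DecidableRel G.Adj] : Prop :=
  Fintype.card V = m + 1 ∧
  ∃ X₁ X₂ X₃ : Finset V,
    Disjoint X₁ X₂ ∧ Disjoint X₁ X₃ ∧ Disjoint X₂ X₃ ∧ X₁ ∪ X₂ ∪ X₃ = Finset.univ ∧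
    (∀ X ∈ [X₁, X₂, X₃],
      (m : ℝ) / 3 - 3 * γ * m ≤ (X.card : ℝ) ∧ (X.card : ℝ) ≤ (m : ℝ) / 3 + 3 * γ * m) ∧
    ((G.interedges X₁ X₂).card : ℝ) ≤ γ ^ 10 * ((X₁.card : ℝ) * (X₂.card : ℝ))

/-- `U` contains at least `k` pairwise (vertex-)disjoint paths of `T` of length `5` (that is, with
five edges), all of whose vertices have degree at most `2` in `T`. -/
def HasDisjointBarePaths {α : Type*} [Fintype α]
    (T : SimpleGraph α) [DecidableRel T.Adj] (U : Finset α) (k : ℕ) : Prop :=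
  ∃ (a b : Fin k → α) (p : ∀ i, T.Walk (a i) (b i)),
    (∀ i, (p i).IsPath ∧ (p i).length = 5 ∧ ∀ x ∈ (p i).support, x ∈ U ∧ T.degree x ≤ 2) ∧
    ∀ i j, i ≠ j → (p i).support.Disjoint (p j).support

/-- The subtree `T*` of the tree `T` with vertex set `U` and root `t` is a `γ`-nice subtree.
A subtree of a tree is the subgraph induced by its vertex set, so it is given by `U` alone. Here
`m` is the number of edges of `T`, and the leaves of `T` are its vertices of degree `1`. -/
structure IsNiceSubtree {α : Type*} [Fintype α] [DecidableEq α] (γ : ℝ) (m : ℕ)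
    (T : SimpleGraph α) [DecidableRel T.Adj] (U : Finset α) (t : α) : Prop where
  edges : T.edgeFinset.card = m
  root_mem : t ∈ U
  isTree : (T.induce (U : Set α)).IsTree
  card_le : (U.card : ℝ) ≤ γ * m
  /-- Every component of `T - T*` is adjacent to the root. -/
  component_adj : ∀ C : (T.induce ((U : Set α)ᶜ)).ConnectedComponent, ∃ x ∈ C.supp, T.Adj t x
  /-- Type 1 or type 2. -/
  type_one_or_two :
    HasDisjointBarePaths T U ⌈γ * m / 20⌉₊ ∨ ⌈γ * m / 40⌉₊ ≤ {x ∈ U | T.degree x = 1}.card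

/-- `φ`, restricted to `A`, is an embedding of `T[A]` into `G - S`: it is injective, avoids `S`
and maps edges to edges. The values of `φ` outside `A` are irrelevant. -/
structure IsEmbeddingOn {α V : Type*} (T : SimpleGraph α) (G : SimpleGraph V)
    (A : Finset α) (S : Finset V) (φ : α → V) : Prop where
  injOn : Set.InjOn φ (A : Set α)
  avoids : ∀ x ∈ A, φ x ∉ S
  map_adj : ∀ x ∈ A, ∀ y ∈ A, T.Adj x y → G.Adj (φ x) (φ y)

/-! Few edges between `X₁` and `X₂` together with the degree condition force almost all edges inside
`X₁`, inside `X₂`, and from either to `X₃`. After deleting few vertices this gives classes `A 0`, `A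
1`, `A 2` in which each vertex misses only a tiny proportion of every class compatible with its own
(`exists_typical_classes`). Hence any assignment of the vertices of `T - T*` to classes that
respects compatibility and leaves a little room in each class can be realised greedily from the root
(`IsEmbeddingOn.exists_extension`). The gap between `|S|` and `|L|` pays for the deleted vertices
and for this room.

It remains to find an assignment with prescribed class sizes near `m/3`
(`exists_compatible_classes`). A bounded set `Z` cuts the tree into pieces of size at most `m/1000`.
Fix a parity `o` of the depth. Vertices of `Z` of parity `o` go to class 2, the others to class 0.
Each piece goes to class 1 or to class 0, except for an independent set of its vertices moved to
class 2. The sizes of these independent sets can be tuned, within limits set by the parity classes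
of the piece and by its contacts with `Z`.

The limits suffice for one of the two parities (`exists_orientation_split`). The only obstructive
pieces have three vertices, two of them of the parity of the top vertex (`good_or_bad`); if nearly
everything consists of such pieces, the opposite parity works with much slack. Singleton pieces go
into the error term, which is small because no vertex has many leaf neighbours (`sum_pieceErr_le`).

The order of choices is essential: `W` must be fixed before `φ_W` is known, whereas the free space
in each class depends on `φ_W`. The parity `o`, and so the class of the root, is therefore chosen
independently of the sizes. -/

/-- `F ∪ {t}` is a tree with root `t`, parent map `par` and depth function `dep`. -/
structure IsRootedTree {α : Type*} [DecidableEq α] (F : Finset α) (t : α) (par : α → α)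
    (dep : α → ℕ) : Prop where
  root_notMem : t ∉ F
  par_mem : ∀ x ∈ F, par x ∈ insert t F
  dep_eq : ∀ x ∈ F, dep x = dep (par x) + 1

/-! ### Cutting a rooted tree into small pieces by a bounded set of vertices -/

namespace IsRootedTree

variable {α : Type*} {F : Finset α} {t : α} {par : α → α} {dep : α → ℕ}

/-- `Anc F par y x`: the vertex `x` is an ancestor of `y` (or `y` itself). -/
def Anc (F : Finset α) (par : α → α) : α → α → Prop :=
  Relation.ReflTransGen fun y x => y ∈ F ∧ par y = x

open Classical in
/-- The descendants of `x` in `F`. -/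
noncomputable def desc (F : Finset α) (par : α → α) (x : α) : Finset α := {y ∈ F | Anc F par y x}

theorem mem_desc {x y : α} : y ∈ desc F par x ↔ y ∈ F ∧ Anc F par y x := by
  classical
  simp [desc]

theorem self_mem_desc {x : α} (hx : x ∈ F) : x ∈ desc F par x :=
  mem_desc.2 ⟨hx, .refl⟩

theorem desc_subset_of_anc {x y : α} (h : Anc F par y x) : desc F par y ⊆ desc F par x :=
  fun _ hz => mem_desc.2 ⟨(mem_desc.1 hz).1, (mem_desc.1 hz).2.trans h⟩

theorem anc_total {x y z : α} (hy : Anc F par z y) (hx : Anc F par z x) :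
    Anc F par y x ∨ Anc F par x y :=
  Relation.ReflTransGen.total_of_right_unique (fun _ _ _ h₁ h₂ => h₁.2.symm.trans h₂.2) hy hx

theorem anc_par_of_ne {x y : α} (h : Anc F par y x) (hne : y ≠ x) :
    y ∈ F ∧ Anc F par (par y) x := by
  rcases Relation.ReflTransGen.cases_head h with h | ⟨z, ⟨h₁, rfl⟩, h₂⟩
  · exact absurd h hne
  · exact ⟨h₁, h₂⟩

theorem anc_child_of_ne {x y : α} (h : Anc F par y x) (hne : y ≠ x) :
    ∃ w ∈ F, par w = x ∧ Anc F par y w := by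
  rcases Relation.ReflTransGen.cases_tail h with h | ⟨z, h₂, h₁, h₃⟩
  · exact absurd h.symm hne
  · exact ⟨z, h₁, h₃, h₂⟩

/-- The number of descendants, in units of `k`. -/
noncomputable def level (F : Finset α) (par : α → α) (k : ℕ) (x : α) : ℕ :=
  (desc F par x).card / k

theorem level_mono {k : ℕ} {x y : α} (h : Anc F par y x) : level F par k y ≤ level F par k x :=
  Nat.div_le_div_right (Finset.card_le_card (desc_subset_of_anc h))

variable [DecidableEq α]

theorem dep_le_of_anc (hT : IsRootedTree F t par dep) {x y : α} (h : Anc F par y x) :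
    dep x ≤ dep y := by
  induction h with
  | refl => exact le_rfl
  | tail _ h ih =>
    have := hT.dep_eq _ h.1
    rw [h.2] at this
    omega

theorem eq_of_anc_of_anc (hT : IsRootedTree F t par dep) {x y : α} (h : Anc F par y x)
    (h' : Anc F par x y) : y = x := by
  by_contra hne
  obtain ⟨hy, h₁⟩ := anc_par_of_ne h hne
  have h₂ := hT.dep_le_of_anc h₁
  have h₃ := hT.dep_le_of_anc h'
  have := hT.dep_eq y hy
  omega

open Classical in
/-- The vertices of `F` at which the level drops. -/
noncomputable def sepF (F : Finset α) (par : α → α) (k : ℕ) : Finset α :=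
  {x ∈ F | 1 ≤ level F par k x ∧ ∀ y ∈ F, par y = x → level F par k y < level F par k x}

theorem mem_sepF {k : ℕ} {x : α} : x ∈ sepF F par k ↔
    x ∈ F ∧ 1 ≤ level F par k x ∧ ∀ y ∈ F, par y = x → level F par k y < level F par k x := by
  classical
  simp [sepF]

/-- Two cut vertices of equal level are never comparable, since the level drops strictly at every
child of a cut vertex. Their descendant sets are therefore disjoint, and each has at least `k`
elements. -/
theorem sepF_level_card {k : ℕ} (hk : 0 < k) (j : ℕ) :
    ((sepF F par k).filter fun x => level F par k x = j).card * k ≤ F.card := by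
  classical
  set Zj := (sepF F par k).filter fun x => level F par k x = j
  have hdisj : (Zj : Set α).PairwiseDisjoint (desc F par) := by
    have key : ∀ x ∈ Zj, ∀ y ∈ Zj, x ≠ y → ¬ Anc F par x y := by
      intro x hx y hy hne h
      obtain ⟨w, hw, hwy, hxw⟩ := anc_child_of_ne h hne
      have h₁ := (mem_sepF.1 (Finset.mem_filter.1 hy).1).2.2 w hw hwy
      have h₂ := level_mono (k := k) hxw
      have h₃ := (Finset.mem_filter.1 hx).2
      have h₄ := (Finset.mem_filter.1 hy).2
      omega
    intro x hx y hy hne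
    refine Finset.disjoint_left.2 fun w hwx hwy => ?_
    rcases anc_total (mem_desc.1 hwx).2 (mem_desc.1 hwy).2 with h | h
    · exact key x hx y hy hne h
    · exact key y hy x hx hne.symm h
  calc Zj.card * k ≤ ∑ x ∈ Zj, (desc F par x).card := by
        rw [← smul_eq_mul]
        refine Finset.card_nsmul_le_sum _ _ _ fun x hx => ?_
        have := (mem_sepF.1 (Finset.mem_filter.1 hx).1).2.1
        exact (Nat.one_le_div_iff hk).1 this
    _ = (Zj.biUnion (desc F par)).card := (Finset.card_biUnion hdisj).symm
    _ ≤ F.card := by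
        refine Finset.card_le_card (Finset.biUnion_subset.2 fun _ _ y hy => (mem_desc.1 hy).1)

theorem sepF_card {k : ℕ} (hk : 0 < k) :
    (sepF F par k).card ≤ (F.card / k) * (F.card / k) := by
  classical
  have hmaps : ∀ x ∈ sepF F par k, level F par k x ∈ Finset.Icc 1 (F.card / k) := by
    intro x hx
    refine Finset.mem_Icc.2 ⟨(mem_sepF.1 hx).2.1, Nat.div_le_div_right (Finset.card_le_card ?_)⟩
    exact fun y hy => (mem_desc.1 hy).1
  have := Finset.card_le_mul_card_image_of_maps_to hmaps (F.card / k) fun j _ =>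
    (Nat.le_div_iff_mul_le hk).2 (sepF_level_card hk j)
  simpa using this

/-- Auxiliary function for `top`: at most `n` steps. -/
def topAux (par : α → α) (Z : Finset α) : ℕ → α → α
  | 0, x => x
  | n + 1, x => if par x ∈ Z then x else topAux par Z n (par x)

/-- The highest vertex that can be reached from `x` in the direction of the root before `Z`. -/
def top (par : α → α) (dep : α → ℕ) (Z : Finset α) (x : α) : α := topAux par Z (dep x) x

theorem top_of_par_mem {Z : Finset α} {x : α} (h : par x ∈ Z) : top par dep Z x = x := by
  unfold top
  cases dep x <;> simp [topAux, h]

/-- The step bound `dep x` of the recursion drops by exactly one in passing to the parent, so the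
climb from `x` continues as the climb from `par x`. -/
theorem top_of_par_notMem (hT : IsRootedTree F t par dep) {Z : Finset α} {x : α} (hx : x ∈ F)
    (h : par x ∉ Z) : top par dep Z x = top par dep Z (par x) := by
  unfold top
  rw [hT.dep_eq x hx]
  simp [topAux, h]

theorem par_mem_F (hT : IsRootedTree F t par dep) {Z : Finset α} (ht : t ∈ Z) {x : α}
    (hx : x ∈ F) (h : par x ∉ Z) : par x ∈ F := by
  rcases Finset.mem_insert.1 (hT.par_mem x hx) with h' | h'
  · exact absurd (h' ▸ ht) h
  · exact h'

theorem top_induction (hT : IsRootedTree F t par dep) {Z : Finset α} (ht : t ∈ Z)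
    {P : α → Prop} (h₁ : ∀ x ∈ F, x ∉ Z → par x ∈ Z → P x)
    (h₂ : ∀ x ∈ F, x ∉ Z → par x ∈ F → par x ∉ Z → P (par x) → P x) :
    ∀ x ∈ F, x ∉ Z → P x := by
  have : ∀ n, ∀ x ∈ F, x ∉ Z → dep x = n → P x := by
    intro n
    induction n with
    | zero =>
      intro x hx _ hn
      have := hT.dep_eq x hx
      omega
    | succ n ih =>
      intro x hx hxZ hn
      by_cases h : par x ∈ Z
      · exact h₁ x hx hxZ h
      · have hp := hT.par_mem_F ht hx h
        refine h₂ x hx hxZ hp h (ih _ hp h ?_)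
        have := hT.dep_eq x hx
        omega
  exact fun x hx hxZ => this _ x hx hxZ rfl

theorem top_spec (hT : IsRootedTree F t par dep) {Z : Finset α} (ht : t ∈ Z) :
    ∀ x ∈ F, x ∉ Z → top par dep Z x ∈ F ∧ top par dep Z x ∉ Z ∧ par (top par dep Z x) ∈ Z ∧
      Anc F par x (top par dep Z x) := by
  refine hT.top_induction ht ?_ ?_
  · intro x hx hxZ h
    rw [top_of_par_mem h]
    exact ⟨hx, hxZ, h, .refl⟩
  · intro x hx hxZ hp h ih
    rw [hT.top_of_par_notMem hx h]
    exact ⟨ih.1, ih.2.1, ih.2.2.1, .head ⟨hx, rfl⟩ ih.2.2.2⟩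

/-- The climb from `x` stops just below `Z`, hence cannot pass an ancestor `z` lying in `Z`. -/
theorem anc_top_of_anc (hT : IsRootedTree F t par dep) {Z : Finset α} (ht : t ∈ Z) {z : α}
    (hz : z ∈ Z) : ∀ x ∈ F, x ∉ Z → Anc F par x z → Anc F par (top par dep Z x) z := by
  refine hT.top_induction ht ?_ ?_
  · intro x hx hxZ h hxz
    rwa [top_of_par_mem h]
  · intro x hx hxZ hp h ih hxz
    rw [hT.top_of_par_notMem hx h]
    exact ih (anc_par_of_ne hxz fun e => hxZ (e ▸ hz)).2

/-- The component of `F \ Z` with highest vertex `r`. -/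
def piece (F : Finset α) (par : α → α) (dep : α → ℕ) (Z : Finset α) (r : α) : Finset α :=
  {x ∈ F \ Z | top par dep Z x = r}

/-- The highest vertices of the components of `F \ Z`. -/
def tops (F : Finset α) (par : α → α) (Z : Finset α) : Finset α := {r ∈ F \ Z | par r ∈ Z}

theorem mem_piece {Z : Finset α} {r x : α} :
    x ∈ piece F par dep Z r ↔ x ∈ F ∧ x ∉ Z ∧ top par dep Z x = r := by
  simp [piece, and_assoc]

theorem mem_tops {Z : Finset α} {r : α} : r ∈ tops F par Z ↔ r ∈ F ∧ r ∉ Z ∧ par r ∈ Z := by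
  simp [tops, and_assoc]

theorem top_mem_tops (hT : IsRootedTree F t par dep) {Z : Finset α} (ht : t ∈ Z) {x : α}
    (hx : x ∈ F) (hxZ : x ∉ Z) : top par dep Z x ∈ tops F par Z := by
  have := hT.top_spec ht x hx hxZ
  exact mem_tops.2 ⟨this.1, this.2.1, this.2.2.1⟩

theorem self_mem_piece {Z : Finset α} {r : α} (hr : r ∈ tops F par Z) :
    r ∈ piece F par dep Z r :=
  mem_piece.2 ⟨(mem_tops.1 hr).1, (mem_tops.1 hr).2.1, top_of_par_mem (mem_tops.1 hr).2.2⟩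

/-- Below a top `r` of positive level, a deepest vertex `z` of the same level is a cut vertex. The
piece avoids the descendants of `z`, and two numbers with the same quotient by `k` differ by less
than `k`. -/
theorem piece_sepF_card_lt (hT : IsRootedTree F t par dep) {k : ℕ} (hk : 0 < k) {r : α}
    (hr : r ∈ tops F par (insert t (sepF F par k))) :
    (piece F par dep (insert t (sepF F par k)) r).card < k := by
  classical
  set Z := insert t (sepF F par k) with hZ
  have ht : t ∈ Z := Finset.mem_insert_self _ _
  obtain ⟨hrF, hrZ, hrp⟩ := mem_tops.1 hr
  have hsub : piece F par dep Z r ⊆ desc F par r := by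
    intro x hx
    obtain ⟨hxF, hxZ, hxr⟩ := mem_piece.1 hx
    exact mem_desc.2 ⟨hxF, hxr ▸ (hT.top_spec ht x hxF hxZ).2.2.2⟩
  by_cases h0 : level F par k r = 0
  · refine (Finset.card_le_card hsub).trans_lt ?_
    rcases Nat.div_eq_zero_iff.1 h0 with h | h <;> omega
  · obtain ⟨z, hz, hmax⟩ := Finset.exists_max_image
      ((desc F par r).filter fun y => level F par k y = level F par k r) dep
      ⟨r, Finset.mem_filter.2 ⟨self_mem_desc hrF, rfl⟩⟩
    obtain ⟨hzr, hzl⟩ := Finset.mem_filter.1 hz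
    obtain ⟨hzF, hzr⟩ := mem_desc.1 hzr
    have hzZ : z ∈ Z := by
      refine Finset.mem_insert_of_mem (mem_sepF.2 ⟨hzF, by omega, fun y hy hyz => ?_⟩)
      have hyz' : Anc F par y z := .single ⟨hy, hyz⟩
      refine lt_of_le_of_ne (level_mono hyz') fun e => ?_
      have := hmax y (Finset.mem_filter.2 ⟨mem_desc.2 ⟨hy, hyz'.trans hzr⟩, e.trans hzl⟩)
      have := hT.dep_eq y hy
      rw [hyz] at this
      omega
    have hsub' : piece F par dep Z r ⊆ desc F par r \ desc F par z := by
      intro x hx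
      refine Finset.mem_sdiff.2 ⟨hsub hx, fun hxz => ?_⟩
      obtain ⟨hxF, hxZ, hxr⟩ := mem_piece.1 hx
      have := hT.anc_top_of_anc ht hzZ x hxF hxZ (mem_desc.1 hxz).2
      rw [hxr] at this
      exact hrZ (hT.eq_of_anc_of_anc this hzr ▸ hzZ)
    have h₁ := Finset.card_le_card hsub'
    have h₂ := Finset.card_sdiff_add_card_eq_card (desc_subset_of_anc hzr)
    have h₃ : (desc F par z).card / k = (desc F par r).card / k := hzl
    have h₄ := Nat.div_add_mod (desc F par z).card k
    have h₅ := Nat.div_add_mod (desc F par r).card k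
    have h₆ := Nat.mod_lt (desc F par r).card hk
    rw [h₃] at h₄
    omega

theorem sum_piece (hT : IsRootedTree F t par dep) {Z : Finset α} (ht : t ∈ Z) :
    ∑ r ∈ tops F par Z, (piece F par dep Z r).card = (F \ Z).card :=
  (Finset.card_eq_sum_card_fiberwise fun _ hx =>
    hT.top_mem_tops ht (Finset.mem_sdiff.1 hx).1 (Finset.mem_sdiff.1 hx).2).symm

end IsRootedTree

/-! ### Choosing the parity and splitting the pieces into two groups -/

/-- A largest intermediate set whose sum stays below `τ` works: one more element would exceed `τ`,
and elements have size at most `k`. -/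
theorem exists_subset_sum_mem_Icc {ι : Type*} [DecidableEq ι] {S₀ S₁ : Finset ι} (hS : S₀ ⊆ S₁)
    {d : ι → ℝ} {τ k : ℝ} (hk : 0 ≤ k) (hd : ∀ r ∈ S₁, d r ≤ k) (h₀ : ∑ r ∈ S₀, d r ≤ τ)
    (h₁ : τ ≤ ∑ r ∈ S₁, d r) :
    ∃ S, S₀ ⊆ S ∧ S ⊆ S₁ ∧ τ - k ≤ ∑ r ∈ S, d r ∧ ∑ r ∈ S, d r ≤ τ := by
  classical
  obtain ⟨S, hSm, hmax⟩ := Finset.exists_max_image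
    (S₁.powerset.filter fun S => S₀ ⊆ S ∧ ∑ r ∈ S, d r ≤ τ) Finset.card
    ⟨S₀, Finset.mem_filter.2 ⟨Finset.mem_powerset.2 hS, subset_rfl, h₀⟩⟩
  obtain ⟨hS₁, hS₀, hle⟩ := Finset.mem_filter.1 hSm
  rw [Finset.mem_powerset] at hS₁
  refine ⟨S, hS₀, hS₁, ?_, hle⟩
  by_cases hSS : S₁ ⊆ S
  · rw [hS₁.antisymm hSS]
    linarith
  · obtain ⟨r, hr, hrS⟩ := Finset.not_subset.1 hSS
    by_contra! hlt
    have hsum := Finset.sum_insert (f := d) hrS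
    have := hmax (insert r S) (Finset.mem_filter.2 ⟨Finset.mem_powerset.2
      (Finset.insert_subset hr hS₁), hS₀.trans (Finset.subset_insert _ _),
      by rw [hsum]; linarith [hd r hr]⟩)
    rw [Finset.card_insert_of_notMem hrS] at this
    omega

/-- Given a family of pieces of sizes `d r` with constraints `lo`, `hi`, `cap` for two
orientations, there is an orientation such that, for all admissible `a` and `b`, the pieces can be
split into two groups within the constraints. -/
theorem exists_orientation_split {ι : Type*} [DecidableEq ι] (R : Finset ι) (d err : ι → ℕ)
    (lo hi cap : Bool → ι → ℕ)
    (husable : ∀ r ∈ R, ∃ o, 4 * lo o r ≤ d r + 4 * err r ∧ d r ≤ 3 * hi o r + 3 * err r)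
    (hcap : ∀ o, ∀ r ∈ R, d r ≤ 3 * cap o r + 3 * err r)
    (hgood : ∀ o, ∀ r ∈ R, 2 * d r ≤ 5 * cap o r + 5 * err r ∨
      (4 * lo o r ≤ d r + 4 * err r ∧ d r ≤ 3 * hi o r + 3 * err r ∧ 3 * lo (!o) r ≤ d r ∧
        2 * d r ≤ 3 * hi (!o) r ∧ d r ≤ 2 * cap (!o) r))
    {m : ℝ} {z : ℕ} (hm : 0 < m) (hd : ∀ r ∈ R, (d r : ℝ) ≤ m / 1000)
    (hN : 998 / 1000 * m ≤ ∑ r ∈ R, (d r : ℝ)) (hN' : ∑ r ∈ R, (d r : ℝ) ≤ m)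
    (herr : ∑ r ∈ R, (err r : ℝ) ≤ m / 5000) (hz : (z : ℝ) ≤ m / 5000) :
    ∃ o, ∀ a b za : ℕ, za ≤ z → m / 3 - m / 500 ≤ a → a ≤ m / 3 + m / 1000 →
      m / 3 - m / 500 ≤ b → b ≤ m / 3 + m / 1000 →
      ∃ B ⊆ R, ∑ r ∈ B, lo o r + b ≤ ∑ r ∈ B, d r ∧ ∑ r ∈ B, d r ≤ b + ∑ r ∈ B, hi o r ∧
        a ≤ ∑ r ∈ R \ B, d r + za ∧ ∑ r ∈ R \ B, d r + za ≤ a + ∑ r ∈ R \ B, cap o r := by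
  classical
  set us : Bool → ι → Prop := fun o r =>
    4 * lo o r ≤ d r + 4 * err r ∧ d r ≤ 3 * hi o r + 3 * err r with hus
  set bad : Bool → ι → Prop := fun o r => ¬ 2 * d r ≤ 5 * cap o r + 5 * err r with hbad
  have hbad' : ∀ o, ∀ r ∈ R, bad o r → us o r ∧ 3 * lo (!o) r ≤ d r ∧
      2 * d r ≤ 3 * hi (!o) r ∧ d r ≤ 2 * cap (!o) r := by
    intro o r hr hb
    rcases hgood o r hr with h | ⟨h₁, h₂, h₃⟩
    · exact absurd h hb
    · exact ⟨⟨h₁, h₂⟩, h₃⟩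
  have hmono : ∀ (f : ι → ℕ) (S S' : Finset ι), S ⊆ S' →
      ∑ r ∈ S, (f r : ℝ) ≤ ∑ r ∈ S', (f r : ℝ) := fun f S S' h =>
    Finset.sum_le_sum_of_subset_of_nonneg h fun _ _ _ => Nat.cast_nonneg _
  have hsplit : ∀ (f : ι → ℕ) (B : Finset ι), B ⊆ R →
      ∑ r ∈ R \ B, (f r : ℝ) + ∑ r ∈ B, (f r : ℝ) = ∑ r ∈ R, (f r : ℝ) := fun f B h =>
    Finset.sum_sdiff h
  -- Every piece is usable for some orientation, so one of the two gets at least half of the total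
  -- weight `0.998 m`.
  obtain ⟨o, ho⟩ : ∃ o, 499 / 1000 * m ≤ ∑ r ∈ R.filter (us o), (d r : ℝ) := by
    by_contra! hcon
    have h₁ : ∑ r ∈ R, (d r : ℝ) ≤
        ∑ r ∈ R.filter (us true), (d r : ℝ) + ∑ r ∈ R.filter (us false), (d r : ℝ) := by
      rw [Finset.sum_filter, Finset.sum_filter, ← Finset.sum_add_distrib]
      refine Finset.sum_le_sum fun r hr => ?_
      have : (0 : ℝ) ≤ d r := Nat.cast_nonneg _
      obtain ⟨o, ho⟩ := husable r hr
      cases o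
      · rw [if_pos (show us false r from ho)]
        split_ifs <;> linarith
      · rw [if_pos (show us true r from ho)]
        split_ifs <;> linarith
    linarith [hcon true, hcon false]
  have hbg : ∑ r ∈ R.filter (bad o), (d r : ℝ) + ∑ r ∈ R.filter (fun r => ¬ bad o r), (d r : ℝ) =
      ∑ r ∈ R, (d r : ℝ) := Finset.sum_filter_add_sum_filter_not _ _ _
  by_cases hg : 150 / 1000 * m ≤ ∑ r ∈ R.filter (fun r => ¬ bad o r), (d r : ℝ)
  · refine ⟨o, fun a b za hza ha ha' hb hb' => ?_⟩
    -- With `B` of weight about `0.494 m`, about `0.16 m` of it must move to class 2; this lies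
    -- between the bounds `1/4` and `1/3` of the weight of `B`. The set `B` takes bad pieces first,
    -- so that good ones remain outside.
    obtain ⟨B, hBu, hB₁, hB₂, hBg⟩ : ∃ B ⊆ R.filter (us o),
        493 / 1000 * m ≤ ∑ r ∈ B, (d r : ℝ) ∧ ∑ r ∈ B, (d r : ℝ) ≤ 494 / 1000 * m ∧
        150 / 1000 * m ≤ ∑ r ∈ (R \ B).filter (fun r => ¬ bad o r), (d r : ℝ) := by
      have hsub : R.filter (bad o) ⊆ R.filter (us o) := fun r hr =>
        Finset.mem_filter.2 ⟨(Finset.mem_filter.1 hr).1,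
          (hbad' o r (Finset.mem_filter.1 hr).1 (Finset.mem_filter.1 hr).2).1⟩
      by_cases hlarge : 494 / 1000 * m ≤ ∑ r ∈ R.filter (bad o), (d r : ℝ)
      · obtain ⟨B, -, hB, h₁, h₂⟩ := exists_subset_sum_mem_Icc (S₀ := ∅)
          (Finset.empty_subset (R.filter (bad o))) (k := m / 1000) (by positivity)
          (fun r hr => hd r (Finset.mem_filter.1 hr).1) (by simp; positivity) hlarge
        refine ⟨B, hB.trans hsub, by linarith, h₂, hg.trans (hmono _ _ _ fun r hr => ?_)⟩
        obtain ⟨hr₁, hr₂⟩ := Finset.mem_filter.1 hr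
        exact Finset.mem_filter.2 ⟨Finset.mem_sdiff.2
          ⟨hr₁, fun h => hr₂ (Finset.mem_filter.1 (hB h)).2⟩, hr₂⟩
      · obtain ⟨B, hB₀, hB, h₁, h₂⟩ := exists_subset_sum_mem_Icc hsub (k := m / 1000)
          (τ := 494 / 1000 * m) (by positivity)
          (fun r hr => hd r (Finset.mem_filter.1 hr).1) (not_le.1 hlarge).le (by linarith)
        refine ⟨B, hB, by linarith, h₂, ?_⟩
        rw [Finset.filter_true_of_mem]
        · have := hsplit d B (hB.trans (Finset.filter_subset _ _))
          linarith
        · intro r hr hb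
          exact (Finset.mem_sdiff.1 hr).2
            (hB₀ (Finset.mem_filter.2 ⟨(Finset.mem_sdiff.1 hr).1, hb⟩))
    have hBR : B ⊆ R := hBu.trans (Finset.filter_subset _ _)
    refine ⟨B, hBR, ?_⟩
    have hza' : (za : ℝ) ≤ m / 5000 := le_trans (by exact_mod_cast hza) hz
    have hza0 : (0 : ℝ) ≤ za := Nat.cast_nonneg _
    have hlo : 4 * ∑ r ∈ B, (lo o r : ℝ) ≤ ∑ r ∈ B, (d r : ℝ) + 4 * ∑ r ∈ B, (err r : ℝ) := by
      rw [Finset.mul_sum, Finset.mul_sum, ← Finset.sum_add_distrib]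
      refine Finset.sum_le_sum fun r hr => ?_
      exact_mod_cast (Finset.mem_filter.1 (hBu hr)).2.1
    have hhi : ∑ r ∈ B, (d r : ℝ) ≤ 3 * ∑ r ∈ B, (hi o r : ℝ) + 3 * ∑ r ∈ B, (err r : ℝ) := by
      rw [Finset.mul_sum, Finset.mul_sum, ← Finset.sum_add_distrib]
      refine Finset.sum_le_sum fun r hr => ?_
      exact_mod_cast (Finset.mem_filter.1 (hBu hr)).2.2
    -- Outside `B`, about `0.175 m` may have to move, slightly more than one third of the weight
    -- there. Good pieces have capacity `2/5` instead of `1/3`; their surplus `1/15` on a weight of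
    -- `0.15 m` makes up the difference.
    have hcapA : 5 * ∑ r ∈ R \ B, (d r : ℝ) +
        ∑ r ∈ (R \ B).filter (fun r => ¬ bad o r), (d r : ℝ) ≤
        15 * ∑ r ∈ R \ B, (cap o r : ℝ) + 15 * ∑ r ∈ R \ B, (err r : ℝ) := by
      rw [Finset.sum_filter, Finset.mul_sum, Finset.mul_sum, Finset.mul_sum,
        ← Finset.sum_add_distrib, ← Finset.sum_add_distrib]
      refine Finset.sum_le_sum fun r hr => ?_
      have h₁ : (d r : ℝ) ≤ 3 * cap o r + 3 * err r := by
        exact_mod_cast hcap o r (Finset.mem_sdiff.1 hr).1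
      split_ifs with h
      · linarith
      · have h₂ : (2 : ℝ) * d r ≤ 5 * cap o r + 5 * err r := by
          exact_mod_cast not_not.1 h
        linarith
    have he := hsplit err B hBR
    have hdA := hsplit d B hBR
    have he₁ := hmono err B R hBR
    have he₂ := hmono err (R \ B) R Finset.sdiff_subset
    refine ⟨?_, ?_, ?_, ?_⟩
    · have : ∑ r ∈ B, (lo o r : ℝ) + b ≤ ∑ r ∈ B, (d r : ℝ) := by linarith
      exact_mod_cast this
    · have : ∑ r ∈ B, (d r : ℝ) ≤ b + ∑ r ∈ B, (hi o r : ℝ) := by linarith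
      exact_mod_cast this
    · have : (a : ℝ) ≤ ∑ r ∈ R \ B, (d r : ℝ) + za := by linarith
      exact_mod_cast this
    · have : ∑ r ∈ R \ B, (d r : ℝ) + za ≤ a + ∑ r ∈ R \ B, (cap o r : ℝ) := by linarith
      exact_mod_cast this
  -- Now more than `0.84 m` is bad for `o`. For `!o` such pieces have bounds `1/3` and `2/3` and
  -- capacity `1/2`, so a set `B` of bad pieces of weight about `0.6 m` leaves ample slack on both
  -- sides.
  · refine ⟨!o, fun a b za hza ha ha' hb hb' => ?_⟩
    obtain ⟨B, -, hB, hB₁, hB₂⟩ := exists_subset_sum_mem_Icc (S₀ := ∅)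
      (Finset.empty_subset (R.filter (bad o))) (k := m / 1000) (τ := 6 / 10 * m) (by positivity)
      (fun r hr => hd r (Finset.mem_filter.1 hr).1) (by simp; positivity) (by linarith)
    have hBR : B ⊆ R := hB.trans (Finset.filter_subset _ _)
    refine ⟨B, hBR, ?_⟩
    have hza' : (za : ℝ) ≤ m / 5000 := le_trans (by exact_mod_cast hza) hz
    have hza0 : (0 : ℝ) ≤ za := Nat.cast_nonneg _
    have hlo : 3 * ∑ r ∈ B, (lo (!o) r : ℝ) ≤ ∑ r ∈ B, (d r : ℝ) := by
      rw [Finset.mul_sum]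
      refine Finset.sum_le_sum fun r hr => ?_
      exact_mod_cast (hbad' o r (hBR hr) (Finset.mem_filter.1 (hB hr)).2).2.1
    have hhi : 2 * ∑ r ∈ B, (d r : ℝ) ≤ 3 * ∑ r ∈ B, (hi (!o) r : ℝ) := by
      rw [Finset.mul_sum, Finset.mul_sum]
      refine Finset.sum_le_sum fun r hr => ?_
      exact_mod_cast (hbad' o r (hBR hr) (Finset.mem_filter.1 (hB hr)).2).2.2.1
    have hcapA : ∑ r ∈ R \ B, (d r : ℝ) ≤ 2 * ∑ r ∈ R \ B, (cap (!o) r : ℝ) +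
        ∑ r ∈ (R \ B).filter (fun r => ¬ bad o r), (d r : ℝ) := by
      rw [Finset.sum_filter, Finset.mul_sum, ← Finset.sum_add_distrib]
      refine Finset.sum_le_sum fun r hr => ?_
      split_ifs with h
      · have : (d r : ℝ) ≤ 2 * cap (!o) r := by
          exact_mod_cast (hbad' o r (Finset.mem_sdiff.1 hr).1 h).2.2.2
        linarith
      · have : (0 : ℝ) ≤ cap (!o) r := Nat.cast_nonneg _
        linarith
    have hgA := hmono d ((R \ B).filter fun r => ¬ bad o r) (R.filter fun r => ¬ bad o r)
      (Finset.filter_subset_filter _ Finset.sdiff_subset)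
    have hdA := hsplit d B hBR
    refine ⟨?_, ?_, ?_, ?_⟩
    · have : ∑ r ∈ B, (lo (!o) r : ℝ) + b ≤ ∑ r ∈ B, (d r : ℝ) := by linarith
      exact_mod_cast this
    · have : ∑ r ∈ B, (d r : ℝ) ≤ b + ∑ r ∈ B, (hi (!o) r : ℝ) := by linarith
      exact_mod_cast this
    · have : (a : ℝ) ≤ ∑ r ∈ R \ B, (d r : ℝ) + za := by linarith
      exact_mod_cast this
    · have : ∑ r ∈ R \ B, (d r : ℝ) + za ≤ a + ∑ r ∈ R \ B, (cap (!o) r : ℝ) := by linarith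
      exact_mod_cast this

/-! ### Parity counts and contacts with `Z` in a single piece -/

namespace IsRootedTree

variable {α : Type*} [DecidableEq α] {F : Finset α} {t : α} {par : α → α} {dep : α → ℕ}

/-- The vertices adjacent to a vertex of `Z`. -/
def touch (F : Finset α) (par : α → α) (Z : Finset α) : Finset α :=
  {x ∈ F | par x ∈ Z} ∪ (Z ∩ F).image par

theorem mem_touch_of_par_mem {Z : Finset α} {x : α} (hx : x ∈ F) (h : par x ∈ Z) :
    x ∈ touch F par Z :=
  Finset.mem_union_left _ (Finset.mem_filter.2 ⟨hx, h⟩)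

theorem par_mem_touch {Z : Finset α} {x : α} (hx : x ∈ F) (h : x ∈ Z) :
    par x ∈ touch F par Z :=
  Finset.mem_union_right _ (Finset.mem_image_of_mem _ (Finset.mem_inter.2 ⟨h, hx⟩))

/-- The number of vertices of `Z` whose parent lies in the piece of `r`. -/
def bottoms (F : Finset α) (par : α → α) (dep : α → ℕ) (Z : Finset α) (r : α) : ℕ :=
  ((Z ∩ F).filter fun z => par z ∈ piece F par dep Z r).card

/-- `r` has no child in `F`. -/
def Childless (F : Finset α) (par : α → α) (r : α) : Prop := ∀ y ∈ F, par y ≠ r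

instance (r : α) : Decidable (Childless F par r) :=
  inferInstanceAs (Decidable (∀ y ∈ F, par y ≠ r))

/-- The error term of a piece in the counting bounds. -/
def pieceErr (F : Finset α) (par : α → α) (dep : α → ℕ) (Z : Finset α) (r : α) : ℕ :=
  bottoms F par dep Z r + if Childless F par r then 1 else 0

/-- The vertices of a piece in the parity class `o`. -/
def hiSet (F : Finset α) (par : α → α) (dep : α → ℕ) (Z : Finset α) (o : Bool) (r : α) :
    Finset α := {x ∈ piece F par dep Z r | (dep x).bodd = o}

/-- The vertices of a piece in the parity class `o` that are adjacent to `Z`. -/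
def loSet (F : Finset α) (par : α → α) (dep : α → ℕ) (Z : Finset α) (o : Bool) (r : α) :
    Finset α := {x ∈ hiSet F par dep Z o r | x ∈ touch F par Z}

/-- The vertices of a piece outside the parity class `o` and not adjacent to `Z`. -/
def freeSet (F : Finset α) (par : α → α) (dep : α → ℕ) (Z : Finset α) (o : Bool) (r : α) :
    Finset α := {x ∈ hiSet F par dep Z (!o) r | x ∉ touch F par Z}

/-- The larger of `hiSet` and `freeSet`. -/
def capSet (F : Finset α) (par : α → α) (dep : α → ℕ) (Z : Finset α) (o : Bool) (r : α) :
    Finset α :=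
  if (freeSet F par dep Z o r).card ≤ (hiSet F par dep Z o r).card then hiSet F par dep Z o r
  else freeSet F par dep Z o r

variable {Z : Finset α} {o : Bool} {r : α}

theorem hiSet_card_le_capSet : (hiSet F par dep Z o r).card ≤ (capSet F par dep Z o r).card := by
  unfold capSet
  split_ifs <;> omega

theorem freeSet_card_le_capSet :
    (freeSet F par dep Z o r).card ≤ (capSet F par dep Z o r).card := by
  unfold capSet
  split_ifs <;> omega

theorem hiSet_subset : hiSet F par dep Z o r ⊆ piece F par dep Z r := Finset.filter_subset _ _

theorem loSet_subset : loSet F par dep Z o r ⊆ hiSet F par dep Z o r := Finset.filter_subset _ _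

theorem capSet_subset : capSet F par dep Z o r ⊆ piece F par dep Z r := by
  unfold capSet
  split_ifs
  · exact hiSet_subset
  · exact (Finset.filter_subset _ _).trans hiSet_subset

theorem card_hiSet_add (o : Bool) :
    (hiSet F par dep Z o r).card + (hiSet F par dep Z (!o) r).card =
      (piece F par dep Z r).card := by
  rw [← Finset.card_filter_add_card_filter_not (s := piece F par dep Z r)
    (fun x => (dep x).bodd = o)]
  congr 2
  refine Finset.filter_congr fun x _ => ?_
  cases (dep x).bodd <;> cases o <;> simp

theorem bodd_dep (hT : IsRootedTree F t par dep) {x : α} (hx : x ∈ F) :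
    (dep x).bodd = !(dep (par x)).bodd := by
  rw [hT.dep_eq x hx, Nat.bodd_succ]

theorem card_hiSet_inter_image_le :
    ((piece F par dep Z r).filter fun x => x ∈ (Z ∩ F).image par).card ≤
      bottoms F par dep Z r := by
  unfold bottoms
  refine (Finset.card_le_card fun x hx => ?_).trans (Finset.card_image_le (f := par))
  obtain ⟨hx, hx'⟩ := Finset.mem_filter.1 hx
  obtain ⟨z, hz, rfl⟩ := Finset.mem_image.1 hx'
  exact Finset.mem_image_of_mem _ (Finset.mem_filter.2 ⟨hz, hx⟩)

theorem eq_top_or_mem_image {x : α} (hx : x ∈ piece F par dep Z r) (h : x ∈ touch F par Z) :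
    x = r ∨ x ∈ (Z ∩ F).image par := by
  rcases Finset.mem_union.1 h with h | h
  · left
    rw [← (mem_piece.1 hx).2.2, top_of_par_mem (Finset.mem_filter.1 h).2]
  · exact .inr h

/-- A vertex of a piece is adjacent to `Z` only by being the top or by being the parent of a vertex
of `Z`. -/
theorem card_touch_le (s : Finset α) (hs : s ⊆ piece F par dep Z r) :
    (s.filter fun x => x ∈ touch F par Z).card ≤
      (if r ∈ s then 1 else 0) + bottoms F par dep Z r := by
  have h₁ : (s.filter fun x => x ∈ touch F par Z) ⊆
      (s.filter fun x => x = r) ∪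
        ((piece F par dep Z r).filter fun x => x ∈ (Z ∩ F).image par) := by
    intro x hx
    obtain ⟨hx, hx'⟩ := Finset.mem_filter.1 hx
    rcases eq_top_or_mem_image (hs hx) hx' with h | h
    · exact Finset.mem_union_left _ (Finset.mem_filter.2 ⟨hx, h⟩)
    · exact Finset.mem_union_right _ (Finset.mem_filter.2 ⟨hs hx, h⟩)
  refine (Finset.card_le_card h₁).trans ((Finset.card_union_le _ _).trans
    (add_le_add ?_ card_hiSet_inter_image_le))
  rw [Finset.filter_eq']
  split_ifs <;> simp

theorem card_freeSet_ge (o : Bool) :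
    (hiSet F par dep Z (!o) r).card ≤ (freeSet F par dep Z o r).card +
      ((if r ∈ hiSet F par dep Z (!o) r then 1 else 0) + bottoms F par dep Z r) := by
  have h₁ := card_touch_le (hiSet F par dep Z (!o) r) hiSet_subset
  have h₂ := Finset.card_filter_add_card_filter_not (s := hiSet F par dep Z (!o) r)
    (fun x => x ∈ touch F par Z)
  unfold freeSet
  omega

theorem mem_hiSet_iff (hr : r ∈ tops F par Z) :
    r ∈ hiSet F par dep Z o r ↔ (dep r).bodd = o := by
  simp [hiSet, self_mem_piece hr]

/-- A piece that is not a singleton meets both parity classes. -/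
theorem hiSet_not_nonempty (hT : IsRootedTree F t par dep) (ht : t ∈ Z) {x : α}
    (hx : x ∈ piece F par dep Z r) (hxr : x ≠ r) (o : Bool) :
    (hiSet F par dep Z o r).Nonempty := by
  obtain ⟨hxF, hxZ, hxt⟩ := mem_piece.1 hx
  have hp : par x ∉ Z := fun h => hxr (by rw [← hxt, top_of_par_mem h])
  have hpx : par x ∈ piece F par dep Z r :=
    mem_piece.2 ⟨hT.par_mem_F ht hxF hp, hp, by rw [← hxt, hT.top_of_par_notMem hxF hp]⟩
  have hb := hT.bodd_dep hxF
  by_cases h : (dep x).bodd = o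
  · exact ⟨x, Finset.mem_filter.2 ⟨hx, h⟩⟩
  · refine ⟨par x, Finset.mem_filter.2 ⟨hpx, ?_⟩⟩
    revert hb h
    cases (dep x).bodd <;> cases (dep (par x)).bodd <;> cases o <;> simp

/-- A child of the only vertex of the piece must lie in `Z` and is counted by `bottoms`; if there is
no child, the `Childless` term counts. -/
theorem one_le_pieceErr_of_singleton (hT : IsRootedTree F t par dep)
    (hr : r ∈ tops F par Z) (h : (piece F par dep Z r).card = 1) :
    1 ≤ pieceErr F par dep Z r := by
  unfold pieceErr
  by_cases hc : Childless F par r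
  · simp [hc]
  · unfold Childless at hc
    push Not at hc
    obtain ⟨y, hy, hyr⟩ := hc
    obtain ⟨s, hs⟩ := Finset.card_eq_one.1 h
    have hrp := self_mem_piece (dep := dep) hr
    have hyZ : y ∈ Z := by
      by_contra hyZ
      have hpZ : par y ∉ Z := hyr ▸ (mem_tops.1 hr).2.1
      have : y ∈ piece F par dep Z r := mem_piece.2 ⟨hy, hyZ, by
        rw [hT.top_of_par_notMem hy hpZ, hyr]; exact (mem_piece.1 hrp).2.2⟩
      rw [hs, Finset.mem_singleton] at this hrp
      have hd := hT.dep_eq y hy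
      rw [hyr, hrp, this] at hd
      omega
    have : 0 < bottoms F par dep Z r :=
      Finset.card_pos.2 ⟨y, Finset.mem_filter.2 ⟨Finset.mem_inter.2 ⟨hyZ, hy⟩, hyr ▸ hrp⟩⟩
    omega

/-- Reduces all later estimates to integer arithmetic: `p` and `q` count the vertices of the parity
of the top and of the other parity, and `b` counts the contacts from below. The top itself causes
the extra `1` in the bounds for its own parity. -/
theorem piece_bounds (hT : IsRootedTree F t par dep) (ht : t ∈ Z) (hr : r ∈ tops F par Z) :
    ∃ p q, (piece F par dep Z r).card = p + q ∧ 1 ≤ p ∧ (2 ≤ p + q → 1 ≤ q) ∧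
      (p + q = 1 → 1 ≤ pieceErr F par dep Z r) ∧
      ∃ b ≤ pieceErr F par dep Z r,
      (b = 0 ∨ 1 ≤ pieceErr F par dep Z r) ∧
      (hiSet F par dep Z (dep r).bodd r).card = p ∧
      (hiSet F par dep Z (!(dep r).bodd) r).card = q ∧
      (loSet F par dep Z (dep r).bodd r).card ≤ 1 + b ∧
      (loSet F par dep Z (!(dep r).bodd) r).card ≤ b ∧
      p ≤ (capSet F par dep Z (dep r).bodd r).card ∧
      q ≤ (capSet F par dep Z (dep r).bodd r).card + b ∧
      q ≤ (capSet F par dep Z (!(dep r).bodd) r).card ∧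
      p ≤ (capSet F par dep Z (!(dep r).bodd) r).card + (1 + b) := by
  set o := (dep r).bodd with ho
  have hb : bottoms F par dep Z r ≤ pieceErr F par dep Z r := Nat.le_add_right _ _
  have hro : r ∈ hiSet F par dep Z o r := (mem_hiSet_iff hr).2 rfl
  have hrno : r ∉ hiSet F par dep Z (!o) r := fun h => by simpa [← ho] using (mem_hiSet_iff hr).1 h
  have h₁ := card_hiSet_add (F := F) (par := par) (dep := dep) (Z := Z) (r := r) o
  have h₂ := card_touch_le _ (hiSet_subset (F := F) (par := par) (dep := dep) (Z := Z) (r := r)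
    (o := o))
  have h₃ := card_touch_le _ (hiSet_subset (F := F) (par := par) (dep := dep) (Z := Z) (r := r)
    (o := !o))
  have h₄ := card_freeSet_ge (F := F) (par := par) (dep := dep) (Z := Z) (r := r) o
  have h₅ := card_freeSet_ge (F := F) (par := par) (dep := dep) (Z := Z) (r := r) (!o)
  rw [Bool.not_not] at h₅
  rw [if_pos hro] at h₂ h₅
  rw [if_neg hrno] at h₃ h₄
  have h₆ := freeSet_card_le_capSet (F := F) (par := par) (dep := dep) (Z := Z) (r := r) (o := o)
  have h₇ := freeSet_card_le_capSet (F := F) (par := par) (dep := dep) (Z := Z) (r := r) (o := !o)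
  refine ⟨_, _, h₁.symm, Finset.card_pos.2 ⟨r, hro⟩, fun h => ?_, fun h => ?_, _, hb, by omega,
    rfl, rfl, h₂, h₃.trans_eq (zero_add _), hiSet_card_le_capSet, by omega, hiSet_card_le_capSet,
    by omega⟩
  · rw [h₁] at h
    obtain ⟨x, hx, hxr⟩ := Finset.exists_mem_ne h r
    exact Finset.card_pos.2 (hT.hiSet_not_nonempty ht hx hxr _)
  · exact hT.one_le_pieceErr_of_singleton hr (h₁.symm.trans h)

/-- The parity opposite to the top has few forced vertices and is preferred. If it is too small,
then `q ≥ 1` forces at least four vertices in the piece, and the single contact at the top is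
affordable. -/
theorem exists_usable (hT : IsRootedTree F t par dep) (ht : t ∈ Z) (hr : r ∈ tops F par Z) :
    ∃ o, 4 * (loSet F par dep Z o r).card ≤
        (piece F par dep Z r).card + 4 * pieceErr F par dep Z r ∧
      (piece F par dep Z r).card ≤
        3 * (hiSet F par dep Z o r).card + 3 * pieceErr F par dep Z r := by
  obtain ⟨p, q, hd, hp, hq, h1, b, hb, hb', h₁, h₂, h₃, h₄, -⟩ := hT.piece_bounds ht hr
  by_cases h : p + q ≤ 3 * q + 3 * pieceErr F par dep Z r
  · exact ⟨!(dep r).bodd, by omega, by omega⟩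
  · exact ⟨(dep r).bodd, by omega, by omega⟩

theorem card_le_three_mul_capSet (hT : IsRootedTree F t par dep) (ht : t ∈ Z)
    (hr : r ∈ tops F par Z) (o : Bool) :
    (piece F par dep Z r).card ≤
      3 * (capSet F par dep Z o r).card + 3 * pieceErr F par dep Z r := by
  obtain ⟨p, q, hd, hp, hq, h1, b, hb, hb', -, -, -, -, h₁, h₂, h₃, h₄⟩ := hT.piece_bounds ht hr
  rcases Bool.eq_or_eq_not o (dep r).bodd with rfl | rfl <;> omega

/-- The capacity is at least `max q (p - 1 - b)` when `o` is not the parity of the top. The first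
alternative then fails only for `p = 2`, `q = 1` with zero error, where the other inequalities hold,
several with equality. -/
theorem good_or_bad (hT : IsRootedTree F t par dep) (ht : t ∈ Z) (hr : r ∈ tops F par Z)
    (o : Bool) :
    2 * (piece F par dep Z r).card ≤
        5 * (capSet F par dep Z o r).card + 5 * pieceErr F par dep Z r ∨
      (4 * (loSet F par dep Z o r).card ≤
          (piece F par dep Z r).card + 4 * pieceErr F par dep Z r ∧
        (piece F par dep Z r).card ≤
          3 * (hiSet F par dep Z o r).card + 3 * pieceErr F par dep Z r ∧
        3 * (loSet F par dep Z (!o) r).card ≤ (piece F par dep Z r).card ∧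
        2 * (piece F par dep Z r).card ≤ 3 * (hiSet F par dep Z (!o) r).card ∧
        (piece F par dep Z r).card ≤ 2 * (capSet F par dep Z (!o) r).card) := by
  obtain ⟨p, q, hd, hp, hq, h1, b, hb, hb', h₁, h₂, h₃, h₄, h₅, h₆, h₇, h₈⟩ :=
    hT.piece_bounds ht hr
  rcases Bool.eq_or_eq_not o (dep r).bodd with rfl | rfl
  · omega
  · rw [Bool.not_not]
    omega

theorem sum_bottoms_le : ∑ r ∈ tops F par Z, bottoms F par dep Z r ≤ (Z ∩ F).card := by
  unfold bottoms
  rw [← Finset.card_biUnion]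
  · exact Finset.card_le_card (Finset.biUnion_subset.2 fun _ _ => Finset.filter_subset _ _)
  · intro r _ r' _ hne
    refine Finset.disjoint_left.2 fun z hz hz' => hne ?_
    rw [← (mem_piece.1 (Finset.mem_filter.1 hz).2).2.2,
      ← (mem_piece.1 (Finset.mem_filter.1 hz').2).2.2]

/-- Contacts from below are charged to distinct vertices of `Z`, and childless tops to their parents
in `Z`. -/
theorem sum_pieceErr_le {l : ℝ}
    (hl : ∀ v ∈ Z, (((F.filter fun x => par x = v ∧ Childless F par x).card : ℕ) : ℝ) ≤ l) :
    ∑ r ∈ tops F par Z, (pieceErr F par dep Z r : ℝ) ≤ (Z ∩ F).card + Z.card * l := by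
  have h₁ : ∑ r ∈ tops F par Z, pieceErr F par dep Z r ≤
      (Z ∩ F).card + ∑ v ∈ Z, (F.filter fun x => par x = v ∧ Childless F par x).card := by
    unfold pieceErr
    rw [Finset.sum_add_distrib]
    refine add_le_add sum_bottoms_le ?_
    rw [← Finset.card_filter]
    refine (Finset.card_le_card fun r hr => ?_).trans Finset.card_biUnion_le
    obtain ⟨hr, hc⟩ := Finset.mem_filter.1 hr
    exact Finset.mem_biUnion.2 ⟨par r, (mem_tops.1 hr).2.2,
      Finset.mem_filter.2 ⟨(mem_tops.1 hr).1, rfl, hc⟩⟩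
  have h₂ : ((∑ r ∈ tops F par Z, pieceErr F par dep Z r : ℕ) : ℝ) ≤
      (Z ∩ F).card + ∑ v ∈ Z,
        (((F.filter fun x => par x = v ∧ Childless F par x).card : ℕ) : ℝ) := by
    exact_mod_cast h₁
  have h₃ := Finset.sum_le_card_nsmul _ _ _ hl
  rw [nsmul_eq_mul] at h₃
  push_cast at h₂
  linarith

end IsRootedTree

/-! ### Distributing the tree among three classes of prescribed sizes -/

/-- The pairs of classes between which edges may be used: all pairs except `(0, 1)`, `(1, 0)` and
`(2, 2)`. -/
def CompatibleClasses (i j : Fin 3) : Prop :=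
  (i = 2 ∧ j ≠ 2) ∨ (i ≠ 2 ∧ (j = 2 ∨ j = i))

instance : ∀ i j, Decidable (CompatibleClasses i j) := fun i j =>
  inferInstanceAs (Decidable ((i = 2 ∧ j ≠ 2) ∨ (i ≠ 2 ∧ (j = 2 ∨ j = i))))

namespace IsRootedTree

variable {α : Type*} [DecidableEq α] {F : Finset α} {t : α} {par : α → α} {dep : α → ℕ}
  {Z : Finset α} {o : Bool}

/-- The assignment of vertices to classes determined by an orientation `o`, a set `B` of pieces
and a set `J` of vertices. -/
def classOf (par : α → α) (dep : α → ℕ) (Z : Finset α) (o : Bool) (B J : Finset α) (x : α) :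
    Fin 3 :=
  if x ∈ Z then if (dep x).bodd = o then 2 else 0
  else if x ∈ J then 2 else if top par dep Z x ∈ B then 1 else 0

/-- Within a piece, `J` is independent because all its vertices have one parity. Across the
boundary, a `Z`-neighbour of a vertex of parity `o` has class 0, which excludes only class 1; a
`Z`-neighbour of a vertex of the other parity has class 2, which excludes only class 2. -/
theorem classOf_compatible (hT : IsRootedTree F t par dep) (ht : t ∈ Z) {B J : Finset α}
    (hJB : ∀ x ∈ J, top par dep Z x ∈ B → (dep x).bodd = o)
    (hJB' : ∀ x ∈ F, x ∉ Z → x ∈ touch F par Z → top par dep Z x ∈ B → (dep x).bodd = o → x ∈ J)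
    (hJ : ∀ x ∈ J, ∀ y ∈ J, top par dep Z x = top par dep Z y → (dep x).bodd = (dep y).bodd)
    (hJ' : ∀ x ∈ J, (dep x).bodd ≠ o → x ∉ touch F par Z) :
    ∀ x ∈ F, CompatibleClasses (classOf par dep Z o B J x) (classOf par dep Z o B J (par x)) := by
  intro x hx
  have hb := hT.bodd_dep hx
  have key : ∀ y ∈ F, y ∉ Z → y ∈ touch F par Z →
      ((dep y).bodd = o → classOf par dep Z o B J y ≠ 1) ∧
      ((dep y).bodd ≠ o → classOf par dep Z o B J y ≠ 2) := by
    intro y hy hyZ hyt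
    simp only [classOf, if_neg hyZ]
    constructor
    · intro hyo
      by_cases h₁ : y ∈ J
      · simp [h₁]
      · by_cases h₂ : top par dep Z y ∈ B
        · exact absurd (hJB' y hy hyZ hyt h₂ hyo) h₁
        · simp [h₁, h₂]
    · intro hyo
      rw [if_neg fun h => hJ' y h hyo hyt]
      split_ifs <;> simp
  by_cases hxZ : x ∈ Z <;> by_cases hpZ : par x ∈ Z
  · have h₁ : classOf par dep Z o B J x = if (dep x).bodd = o then 2 else 0 := if_pos hxZ
    have h₂ : classOf par dep Z o B J (par x) = if (dep (par x)).bodd = o then 2 else 0 :=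
      if_pos hpZ
    rw [h₁, h₂, hb]
    cases (dep (par x)).bodd <;> cases o <;> decide
  · have h₁ : classOf par dep Z o B J x = if (dep x).bodd = o then 2 else 0 := if_pos hxZ
    have h₂ := key (par x) (hT.par_mem_F ht hx hpZ) hpZ (par_mem_touch hx hxZ)
    rw [h₁, hb]
    revert h₂
    generalize classOf par dep Z o B J (par x) = c
    revert c
    cases (dep (par x)).bodd <;> cases o <;> decide
  · have h₁ : classOf par dep Z o B J (par x) = if (dep (par x)).bodd = o then 2 else 0 :=
      if_pos hpZ
    have h₂ := key x hx hxZ (mem_touch_of_par_mem hx hpZ)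
    rw [h₁]
    rw [hb] at h₂
    revert h₂
    generalize classOf par dep Z o B J x = c
    revert c
    cases (dep (par x)).bodd <;> cases o <;> decide
  · have htop := hT.top_of_par_notMem hx hpZ
    simp only [classOf, if_neg hxZ, if_neg hpZ, ← htop]
    by_cases h₁ : x ∈ J <;> by_cases h₂ : par x ∈ J
    · have := hJ x h₁ _ h₂ htop
      rw [hb] at this
      simp at this
    all_goals
      simp only [h₁, h₂, if_true, if_false]
      split_ifs <;> decide

theorem card_biUnion_of_subset_piece {B : Finset α} (g : α → Finset α)
    (hg : ∀ r ∈ B, g r ⊆ piece F par dep Z r) :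
    (B.biUnion g).card = ∑ r ∈ B, (g r).card := by
  refine Finset.card_biUnion fun r hr r' hr' hne => Finset.disjoint_left.2 fun z hz hz' => hne ?_
  rw [← (mem_piece.1 (hg r hr hz)).2.2, ← (mem_piece.1 (hg r' hr' hz')).2.2]

/-- The hypotheses say exactly that the number of vertices to be moved to class 2 is attainable:
between the `loSet` and `hiSet` totals inside `B`, and at most the `capSet` total outside `B`. -/
theorem exists_classOf (hT : IsRootedTree F t par dep) (ht : t ∈ Z) {B : Finset α}
    {a b : ℕ}
    (h₁ : ∑ r ∈ B, (loSet F par dep Z o r).card + b ≤ ∑ r ∈ B, (piece F par dep Z r).card)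
    (h₂ : ∑ r ∈ B, (piece F par dep Z r).card ≤ b + ∑ r ∈ B, (hiSet F par dep Z o r).card)
    (h₃ : a ≤ ∑ r ∈ tops F par Z \ B, (piece F par dep Z r).card +
      ((Z ∩ F).filter fun x => (dep x).bodd ≠ o).card)
    (h₄ : ∑ r ∈ tops F par Z \ B, (piece F par dep Z r).card +
        ((Z ∩ F).filter fun x => (dep x).bodd ≠ o).card ≤
      a + ∑ r ∈ tops F par Z \ B, (capSet F par dep Z o r).card) :
    ∃ f : α → Fin 3, f t = (if (dep t).bodd = o then 2 else 0) ∧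
      (∀ x ∈ F, CompatibleClasses (f x) (f (par x))) ∧
      (F.filter fun x => f x = 0).card = a ∧ (F.filter fun x => f x = 1).card = b := by
  have c₁ := card_biUnion_of_subset_piece (B := B) (piece F par dep Z) fun _ _ => subset_rfl
  have c₂ := card_biUnion_of_subset_piece (B := B) (loSet F par dep Z o) fun _ _ =>
    loSet_subset.trans hiSet_subset
  have c₃ := card_biUnion_of_subset_piece (B := B) (hiSet F par dep Z o) fun _ _ => hiSet_subset
  have c₄ := card_biUnion_of_subset_piece (B := tops F par Z \ B) (piece F par dep Z)
    fun _ _ => subset_rfl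
  have c₅ := card_biUnion_of_subset_piece (B := tops F par Z \ B) (capSet F par dep Z o)
    fun _ _ => capSet_subset
  obtain ⟨JB, hJB₁, hJB₂, hJBc⟩ := Finset.exists_subsuperset_card_eq
    (s := B.biUnion (loSet F par dep Z o)) (t := B.biUnion (hiSet F par dep Z o))
    (n := ∑ r ∈ B, (piece F par dep Z r).card - b)
    (Finset.biUnion_mono fun _ _ => loSet_subset) (by omega) (by omega)
  obtain ⟨JA, hJA, hJAc⟩ := Finset.exists_subset_card_eq
    (s := (tops F par Z \ B).biUnion (capSet F par dep Z o))
    (n := ∑ r ∈ tops F par Z \ B, (piece F par dep Z r).card +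
      ((Z ∩ F).filter fun x => (dep x).bodd ≠ o).card - a) (by omega)
  have hJBs : ∀ x ∈ JB, x ∈ F ∧ x ∉ Z ∧ top par dep Z x ∈ B ∧ (dep x).bodd = o := by
    intro x hx
    obtain ⟨r, hr, hxr⟩ := Finset.mem_biUnion.1 (hJB₂ hx)
    obtain ⟨hx₁, hx₂⟩ := Finset.mem_filter.1 hxr
    obtain ⟨hx₃, hx₄, hx₅⟩ := mem_piece.1 hx₁
    exact ⟨hx₃, hx₄, hx₅ ▸ hr, hx₂⟩
  have hJAs : ∀ x ∈ JA, x ∈ F ∧ x ∉ Z ∧ top par dep Z x ∉ B ∧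
      x ∈ capSet F par dep Z o (top par dep Z x) := by
    intro x hx
    obtain ⟨r, hr, hxr⟩ := Finset.mem_biUnion.1 (hJA hx)
    obtain ⟨hx₃, hx₄, hx₅⟩ := mem_piece.1 (capSet_subset hxr)
    subst hx₅
    exact ⟨hx₃, hx₄, (Finset.mem_sdiff.1 hr).2, hxr⟩
  have hcomp : ∀ x ∈ F, CompatibleClasses (classOf par dep Z o B (JB ∪ JA) x)
      (classOf par dep Z o B (JB ∪ JA) (par x)) := by
    refine hT.classOf_compatible ht ?_ ?_ ?_ ?_
    · intro x hx hxB
      rcases Finset.mem_union.1 hx with h | h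
      · exact (hJBs x h).2.2.2
      · exact absurd hxB (hJAs x h).2.2.1
    · intro x hxF hxZ hxt hxB hxo
      refine Finset.mem_union_left _ (hJB₁ (Finset.mem_biUnion.2 ⟨_, hxB, ?_⟩))
      exact Finset.mem_filter.2 ⟨Finset.mem_filter.2 ⟨mem_piece.2 ⟨hxF, hxZ, rfl⟩, hxo⟩, hxt⟩
    · intro x hx y hy hxy
      rcases Finset.mem_union.1 hx with h | h <;> rcases Finset.mem_union.1 hy with h' | h'
      · rw [(hJBs x h).2.2.2, (hJBs y h').2.2.2]
      · exact absurd (hxy ▸ (hJBs x h).2.2.1) (hJAs y h').2.2.1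
      · exact absurd (hxy ▸ (hJBs y h').2.2.1) (hJAs x h).2.2.1
      · have hx' := (hJAs x h).2.2.2
        have hy' := (hJAs y h').2.2.2
        rw [hxy] at hx'
        unfold capSet at hx' hy'
        split_ifs at hx' hy'
        · rw [(Finset.mem_filter.1 hx').2, (Finset.mem_filter.1 hy').2]
        · rw [(Finset.mem_filter.1 (Finset.mem_filter.1 hx').1).2,
            (Finset.mem_filter.1 (Finset.mem_filter.1 hy').1).2]
    · intro x hx hxo
      rcases Finset.mem_union.1 hx with h | h
      · exact absurd (hJBs x h).2.2.2 hxo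
      · have hx' := (hJAs x h).2.2.2
        unfold capSet at hx'
        split_ifs at hx'
        · exact absurd (Finset.mem_filter.1 hx').2 hxo
        · exact (Finset.mem_filter.1 hx').2
  refine ⟨classOf par dep Z o B (JB ∪ JA), if_pos ht, hcomp, ?_, ?_⟩
  · have hset : (F.filter fun x => classOf par dep Z o B (JB ∪ JA) x = 0) =
        (((tops F par Z \ B).biUnion (piece F par dep Z)) \ JA) ∪
          ((Z ∩ F).filter fun x => (dep x).bodd ≠ o) := by
      ext x
      simp only [Finset.mem_filter, Finset.mem_union, Finset.mem_sdiff, Finset.mem_biUnion,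
        Finset.mem_inter, mem_piece]
      constructor
      · rintro ⟨hx, hf⟩
        by_cases hxZ : x ∈ Z
        · right
          simp only [classOf, if_pos hxZ] at hf
          refine ⟨⟨hxZ, hx⟩, fun h => ?_⟩
          simp [h] at hf
        · left
          simp only [classOf, if_neg hxZ] at hf
          have hxJ : x ∉ JB ∪ JA := fun h => by simp [h] at hf
          rw [if_neg hxJ] at hf
          have hxB : top par dep Z x ∉ B := fun h => by simp [h] at hf
          exact ⟨⟨_, ⟨hT.top_mem_tops ht hx hxZ, hxB⟩, hx, hxZ, rfl⟩,
            fun h => hxJ (Finset.mem_union_right _ h)⟩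
      · rintro (⟨⟨r, ⟨hr, hrB⟩, hx, hxZ, rfl⟩, hxJ⟩ | ⟨⟨hxZ, hx⟩, ho⟩)
        · refine ⟨hx, ?_⟩
          have hxJ' : x ∉ JB ∪ JA := fun h => by
            rcases Finset.mem_union.1 h with h | h
            · exact hrB (hJBs x h).2.2.1
            · exact hxJ h
          simp only [classOf, if_neg hxZ, if_neg hxJ', if_neg hrB]
        · exact ⟨hx, by simp only [classOf, if_pos hxZ, if_neg ho]⟩
    have hsub : JA ⊆ (tops F par Z \ B).biUnion (piece F par dep Z) :=
      hJA.trans (Finset.biUnion_mono fun _ _ => capSet_subset)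
    rw [hset, Finset.card_union_of_disjoint, Finset.card_sdiff_of_subset hsub]
    · have := Finset.card_le_card hsub
      omega
    · refine Finset.disjoint_left.2 fun x hx hx' => ?_
      obtain ⟨r, -, hxr⟩ := Finset.mem_biUnion.1 (Finset.mem_sdiff.1 hx).1
      exact (mem_piece.1 hxr).2.1 (Finset.mem_inter.1 (Finset.mem_filter.1 hx').1).1
  · have hset : (F.filter fun x => classOf par dep Z o B (JB ∪ JA) x = 1) =
        (B.biUnion (piece F par dep Z)) \ JB := by
      ext x
      simp only [Finset.mem_filter, Finset.mem_sdiff, Finset.mem_biUnion, mem_piece]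
      constructor
      · rintro ⟨hx, hf⟩
        have hxZ : x ∉ Z := fun h => by
          simp only [classOf, if_pos h] at hf
          split_ifs at hf <;> simp at hf
        simp only [classOf, if_neg hxZ] at hf
        have hxJ : x ∉ JB ∪ JA := fun h => by simp [h] at hf
        rw [if_neg hxJ] at hf
        have hxB : top par dep Z x ∈ B := by
          by_contra h
          simp [h] at hf
        exact ⟨⟨_, hxB, hx, hxZ, rfl⟩, fun h => hxJ (Finset.mem_union_left _ h)⟩
      · rintro ⟨⟨r, hrB, hx, hxZ, rfl⟩, hxJ⟩
        refine ⟨hx, ?_⟩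
        have hxJ' : x ∉ JB ∪ JA := fun h => by
          rcases Finset.mem_union.1 h with h | h
          · exact hxJ h
          · exact (hJAs x h).2.2.1 hrB
        simp only [classOf, if_neg hxZ, if_neg hxJ', if_pos hrB]
    have hsub : JB ⊆ B.biUnion (piece F par dep Z) :=
      hJB₂.trans (Finset.biUnion_mono fun _ _ => hiSet_subset)
    rw [hset, Finset.card_sdiff_of_subset hsub]
    have := Finset.card_le_card hsub
    omega

/-- A tree in which no vertex has many childless children can be distributed among three classes of
prescribed sizes close to `m / 3`, where the class of the root does not depend on the sizes. -/
theorem exists_compatible_classes (hT : IsRootedTree F t par dep) {m : ℕ} (hm : 10 ^ 11 ≤ m)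
    (hF : 999 / 1000 * (m : ℝ) ≤ F.card) (hF' : F.card ≤ m)
    (hleaf : ∀ v ∈ insert t F,
      ((F.filter fun x => par x = v ∧ Childless F par x).card : ℝ) ≤ 1 / 10 ^ 10 * m) :
    ∃ i₀ : Fin 3, (i₀ = 0 ∨ i₀ = 2) ∧ ∀ a b c : ℕ,
      (m : ℝ) / 3 - m / 500 ≤ a → (a : ℝ) ≤ m / 3 + m / 1000 →
      (m : ℝ) / 3 - m / 500 ≤ b → (b : ℝ) ≤ m / 3 + m / 1000 → F.card ≤ a + b + c →
      ∃ f : α → Fin 3, f t = i₀ ∧ (∀ x ∈ F, CompatibleClasses (f x) (f (par x))) ∧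
        (F.filter fun x => f x = 0).card ≤ a ∧ (F.filter fun x => f x = 1).card ≤ b ∧
        (F.filter fun x => f x = 2).card ≤ c := by
  have hm' : (10 : ℝ) ^ 11 ≤ m := by exact_mod_cast hm
  -- This gives at most 1000 levels with at most 1000 cut vertices each, and pieces of size at most
  -- `m / 1000`.
  set k := ⌈(m : ℝ) / 1000⌉₊ with hkdef
  have hk : 0 < k := Nat.ceil_pos.2 (by linarith)
  have hkm : F.card ≤ 1000 * k := by
    have := Nat.le_ceil ((m : ℝ) / 1000)
    have h₁ : (m : ℝ) ≤ 1000 * k := by linarith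
    have h₂ : m ≤ 1000 * k := by exact_mod_cast h₁
    omega
  have hdiv : F.card / k ≤ 1000 := Nat.div_le_of_le_mul (by rwa [mul_comm] at hkm)
  have hsep : (sepF F par k).card ≤ 1000 * 1000 := (sepF_card hk).trans (Nat.mul_le_mul hdiv hdiv)
  set Z := insert t (sepF F par k) with hZ
  have ht : t ∈ Z := Finset.mem_insert_self _ _
  have hZF : Z ⊆ insert t F := Finset.insert_subset_insert _ fun x hx => (mem_sepF.1 hx).1
  have hZcard : Z.card ≤ 1000 * 1000 + 1 := (Finset.card_insert_le _ _).trans (by omega)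
  have hZFcard : (Z ∩ F).card ≤ 1000 * 1000 := by
    refine (Finset.card_le_card fun x hx => ?_).trans hsep
    obtain ⟨h₁, h₂⟩ := Finset.mem_inter.1 hx
    exact Finset.mem_of_mem_insert_of_ne h₁ fun h => hT.root_notMem (h ▸ h₂)
  have hZr : ((Z ∩ F).card : ℝ) ≤ 1000 * 1000 := by exact_mod_cast hZFcard
  have hZr' : (Z.card : ℝ) ≤ 1000 * 1000 + 1 := by exact_mod_cast hZcard
  have hsum := hT.sum_piece ht
  have hsd := Finset.card_sdiff_add_card_inter F Z
  rw [Finset.inter_comm] at hsd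
  have hsumr : ∑ r ∈ tops F par Z, ((piece F par dep Z r).card : ℝ) + (Z ∩ F).card = F.card := by
    exact_mod_cast hsum ▸ hsd
  have hF'' : (F.card : ℝ) ≤ m := by exact_mod_cast hF'
  have hz0 : (0 : ℝ) ≤ (Z ∩ F).card := Nat.cast_nonneg _
  have herr := sum_pieceErr_le (dep := dep) fun v hv => hleaf v (hZF hv)
  obtain ⟨o, ho⟩ := exists_orientation_split (tops F par Z)
    (fun r => (piece F par dep Z r).card) (pieceErr F par dep Z)
    (fun o r => (loSet F par dep Z o r).card) (fun o r => (hiSet F par dep Z o r).card)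
    (fun o r => (capSet F par dep Z o r).card) (m := m) (z := (Z ∩ F).card)
    (fun r hr => hT.exists_usable ht hr) (fun o r hr => hT.card_le_three_mul_capSet ht hr o)
    (fun o r hr => hT.good_or_bad ht hr o) (by linarith)
    (fun r hr => (Nat.lt_ceil.1 (hT.piece_sepF_card_lt hk hr)).le) (by linarith) (by linarith)
    -- The total error is at most `10⁶ + (10⁶ + 1) · 10⁻¹⁰ m`, which is below `m / 5000` since `m ≥
    -- 10¹¹`.
    (by
      have : (Z.card : ℝ) * (1 / 10 ^ 10 * m) ≤ (1000 * 1000 + 1) * (1 / 10 ^ 10 * m) := by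
        gcongr
      linarith)
    (by linarith)
  refine ⟨if (dep t).bodd = o then 2 else 0, by split_ifs <;> simp,
    fun a b c ha ha' hb hb' habc => ?_⟩
  obtain ⟨B, -, h₁, h₂, h₃, h₄⟩ := ho a b ((Z ∩ F).filter fun x => (dep x).bodd ≠ o).card
    (Finset.card_filter_le _ _) ha ha' hb hb'
  obtain ⟨f, hft, hf, hfa, hfb⟩ := hT.exists_classOf ht h₁ h₂ h₃ h₄
  refine ⟨f, hft, hf, hfa.le, hfb.le, ?_⟩
  -- Classes 0 and 1 are filled exactly, so class 2 receives `F.card - a - b ≤ c` vertices.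
  have hall := Finset.card_eq_sum_card_fiberwise (f := f) (s := F) (t := Finset.univ)
    fun _ _ => Finset.mem_coe.2 (Finset.mem_univ _)
  rw [Fin.sum_univ_three, hfa, hfb] at hall
  omega

end IsRootedTree

/-! ### The complement of a nice subtree as a tree hanging from the root -/

namespace SimpleGraph

variable {α : Type*} {T : SimpleGraph α}

theorem IsTree.exists_parent (hT : T.IsTree) (t : α) {x : α} (hx : x ≠ t) :
    ∃ y, T.Adj x y ∧ T.dist t x = T.dist t y + 1 := by
  obtain ⟨p, -, hp⟩ := hT.connected.exists_path_of_dist x t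
  cases p with
  | nil => exact absurd rfl hx
  | @cons _ y _ h q =>
    refine ⟨y, h, ?_⟩
    rw [Walk.length_cons, dist_comm] at hp
    have h₁ := T.dist_le q
    rw [dist_comm] at h₁
    rcases hT.dist_eq_dist_add_one_of_adj t h with h₂ | h₂ <;> omega

/-- Any neighbour of `x` closer to `t` must be the penultimate vertex of the shortest path from `t`
to `x`; otherwise its own path to `t` would pass through `x` and be too long. -/
theorem IsTree.parent_unique (hT : T.IsTree) (t : α) {x y z : α} (hy : T.Adj x y)
    (hyd : T.dist t x = T.dist t y + 1) (hz : T.Adj x z) (hzd : T.dist t x = T.dist t z + 1) :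
    y = z := by
  obtain ⟨q, hq, hql⟩ := hT.connected.exists_path_of_dist t x
  have key : ∀ w, T.Adj x w → T.dist t x = T.dist t w + 1 → w = q.penultimate := by
    intro w hw hwd
    refine hT.isAcyclic.eq_penultimate_of_adj_end hq hw ?_
    by_contra hwq
    obtain ⟨p, hp, hpl⟩ := hT.connected.exists_path_of_dist t w
    have hx := hT.isAcyclic.mem_support_of_ne_mem_support_of_adj_of_isPath hp hq hw.symm hwq
    have := congrArg Walk.length (hT.isAcyclic.path_concat hq hp hw hx)
    rw [Walk.length_concat] at this
    omega
  rw [key y hy hyd, key z hz hzd]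

/-- In an acyclic graph, a connected set `U` and a component of its complement are joined by at most
one edge. -/
theorem IsAcyclic.eq_of_adj_of_component (hT : T.IsAcyclic) {U : Set α}
    (hU : (T.induce U).Preconnected) {t : α} (ht : t ∈ U)
    (hC : ∀ C : (T.induce Uᶜ).ConnectedComponent, ∃ x ∈ C.supp, T.Adj t x) {x u : α} (hx : x ∉ U)
    (hu : u ∈ U) (hxu : T.Adj x u) : u = t := by
  by_contra hne
  obtain ⟨y, hy, hty⟩ := hC ((T.induce Uᶜ).connectedComponentMk ⟨x, hx⟩)
  have hyx : (T.induce Uᶜ).Reachable y ⟨x, hx⟩ := ConnectedComponent.exact hy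
  have hut : (T.induce U).Reachable ⟨u, hu⟩ ⟨t, ht⟩ := hU _ _
  -- If `u ≠ t`, then `u` reaches `t` inside `U`, `t` is adjacent to `y`, and `y` reaches `x`
  -- outside `U`. This walk avoids the edge `xu`, which is a bridge.
  have hb := (isAcyclic_iff_forall_adj_isBridge.1 hT hxu)
  rw [isBridge_iff] at hb
  have e₁ : (T.deleteEdges {s(x, u)}).Reachable (y : α) x := by
    refine hyx.map (⟨Subtype.val, ?_⟩ : T.induce Uᶜ →g T.deleteEdges {s(x, u)})
    intro v w hvw
    refine deleteEdges_adj.2 ⟨hvw, fun h => ?_⟩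
    rcases Sym2.eq_iff.1 (Set.mem_singleton_iff.1 h) with ⟨-, h⟩ | ⟨h, -⟩
    · exact w.2 (h ▸ hu)
    · exact v.2 (h ▸ hu)
  have e₂ : (T.deleteEdges {s(x, u)}).Reachable u t := by
    refine hut.map (⟨Subtype.val, ?_⟩ : T.induce U →g T.deleteEdges {s(x, u)})
    intro v w hvw
    refine deleteEdges_adj.2 ⟨hvw, fun h => ?_⟩
    rcases Sym2.eq_iff.1 (Set.mem_singleton_iff.1 h) with ⟨h, -⟩ | ⟨-, h⟩
    · exact hx (h ▸ v.2)
    · exact hx (h ▸ w.2)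
  have e₃ : (T.deleteEdges {s(x, u)}).Adj t y := by
    refine deleteEdges_adj.2 ⟨hty, fun h => ?_⟩
    rcases Sym2.eq_iff.1 (Set.mem_singleton_iff.1 h) with ⟨h, -⟩ | ⟨h, -⟩
    · exact hx (h ▸ ht)
    · exact hne h.symm
  have := (e₂.trans (e₃.reachable.trans e₁)).symm
  exact hb this

end SimpleGraph

/-- The complement of a nice subtree is a tree hanging from the root. -/
theorem IsNiceSubtree.exists_isRootedTree {α : Type*} [Fintype α] [DecidableEq α] {γ : ℝ} {m : ℕ}
    {T : SimpleGraph α} [DecidableRel T.Adj] {U : Finset α} {t : α} (hT : T.IsTree)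
    (h : IsNiceSubtree γ m T U t) :
    ∃ par dep, IsRootedTree Uᶜ t par dep ∧ (∀ x ∈ Uᶜ, T.Adj x (par x)) ∧
      ∀ x ∈ Uᶜ, ∀ y, T.Adj x y → y = par x ∨ (y ∈ Uᶜ ∧ par y = x) := by
  have hex : ∀ x, ∃ y, x ≠ t → T.Adj x y ∧ T.dist t x = T.dist t y + 1 := by
    intro x
    by_cases hx : x = t
    · exact ⟨x, fun h => absurd hx h⟩
    · obtain ⟨y, hy⟩ := hT.exists_parent t hx
      exact ⟨y, fun _ => hy⟩
  choose par hpar using hex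
  have hU : ∀ x ∈ Uᶜ, ∀ y, T.Adj x y → y ∈ U → y = t := fun x hx y hxy hy =>
    hT.isAcyclic.eq_of_adj_of_component h.isTree.connected.preconnected
      (Finset.mem_coe.2 h.root_mem) h.component_adj
      (fun hx' => Finset.mem_compl.1 hx (Finset.mem_coe.1 hx')) (Finset.mem_coe.2 hy) hxy
  have hne : ∀ x ∈ Uᶜ, x ≠ t := fun x hx e => Finset.mem_compl.1 hx (e ▸ h.root_mem)
  refine ⟨par, T.dist t, ⟨by simpa using h.root_mem, fun x hx => ?_, fun x hx =>
    (hpar x (hne x hx)).2⟩, fun x hx => (hpar x (hne x hx)).1, fun x hx y hxy => ?_⟩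
  · by_cases hp : par x ∈ U
    · rw [hU x hx _ (hpar x (hne x hx)).1 hp]
      exact Finset.mem_insert_self _ _
    · exact Finset.mem_insert_of_mem (Finset.mem_compl.2 hp)
  · have hx' := hpar x (hne x hx)
    rcases hT.dist_eq_dist_add_one_of_adj t hxy with hd | hd
    · exact .inl (hT.parent_unique t hxy hd hx'.1 hx'.2)
    · have hyt : y ≠ t := by
        rintro rfl
        simp at hd
      have hy' := hpar y hyt
      refine .inr ⟨Finset.mem_compl.2 fun hy => hyt (hU x hx y hxy hy), ?_⟩
      exact hT.parent_unique t hy'.1 hy'.2 hxy.symm hd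

/-! ### Nearly complete classes in a special graph -/

theorem card_filter_not_le_mul_le {ι : Type*} (s : Finset ι) (g : ι → ℕ) {τ E : ℝ}
    (h : ∑ x ∈ s, (g x : ℝ) ≤ E) [DecidablePred fun x => ¬ (g x : ℝ) ≤ τ] :
    ((s.filter fun x => ¬ (g x : ℝ) ≤ τ).card : ℝ) * τ ≤ E := by
  refine le_trans ?_ h
  rw [← nsmul_eq_mul]
  refine (Finset.card_nsmul_le_sum _ (fun x => (g x : ℝ)) τ fun x hx => ?_).trans
    (Finset.sum_le_sum_of_subset_of_nonneg (Finset.filter_subset _ _)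
      fun _ _ _ => Nat.cast_nonneg _)
  exact (not_le.1 (Finset.mem_filter.1 hx).2).le

section Graph

variable {V : Type*} {G : SimpleGraph V} [DecidableRel G.Adj]

theorem card_interedges_eq_sum (X Y : Finset V) :
    (G.interedges X Y).card = ∑ v ∈ X, (Y.filter fun w => G.Adj v w).card := by
  have : G.interedges X Y = (X ×ˢ Y).filter fun e => G.Adj e.1 e.2 := rfl
  rw [this, Finset.card_filter, Finset.sum_product]
  exact Finset.sum_congr rfl fun v _ => (Finset.card_filter _ _).symm

/-- Non-adjacent pairs between `A` and `C` are counted from both sides. -/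
theorem card_atypical_mul_le {A C : Finset V} {η κ : ℝ}
    (h : ∀ v ∈ A, ((C.filter fun w => ¬ G.Adj v w).card : ℝ) ≤ η)
    [DecidablePred fun w => ¬ ((A.filter fun v => ¬ G.Adj w v).card : ℝ) ≤ κ] :
    ((C.filter fun w => ¬ ((A.filter fun v => ¬ G.Adj w v).card : ℝ) ≤ κ).card : ℝ) * κ ≤
      A.card * η := by
  refine card_filter_not_le_mul_le C (fun w => (A.filter fun v => ¬ G.Adj w v).card) ?_
  have h₁ : ∑ w ∈ C, (A.filter fun v => ¬ G.Adj w v).card =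
      ∑ v ∈ A, (C.filter fun w => ¬ G.Adj v w).card := by
    simp only [Finset.card_filter]
    rw [Finset.sum_comm]
    simp only [G.adj_comm]
  have h₂ := Finset.sum_le_card_nsmul A (fun v => ((C.filter fun w => ¬ G.Adj v w).card : ℝ)) η h
  rw [nsmul_eq_mul] at h₂
  refine le_trans (le_of_eq ?_) h₂
  exact_mod_cast h₁

variable [Fintype V] [DecidableEq V]

/-- If there are few edges between `X` and `Y`, then most vertices of `X` are adjacent to almost all
of `X` and `Z`. -/
theorem exists_typical_of_sparse {X Y Z : Finset V} (hcov : X ∪ Y ∪ Z = Finset.univ) {m γ : ℝ}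
    (hm : 1 ≤ γ * m) (hX : (X.card : ℝ) ≤ m / 3 + 3 * γ * m)
    (hZ : (Z.card : ℝ) ≤ m / 3 + 3 * γ * m) (hdeg : ∀ v, 2 * m / 3 - 1 ≤ G.degree v)
    (he : ((G.interedges X Y).card : ℝ) ≤ γ * m * (γ * m)) :
    ∃ A ⊆ X, X.card - γ * m ≤ A.card ∧
      ∀ v ∈ A, ((X.filter fun w => ¬ G.Adj v w).card : ℝ) ≤ 8 * γ * m ∧
        ((Z.filter fun w => ¬ G.Adj v w).card : ℝ) ≤ 8 * γ * m := by
  classical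
  refine ⟨X.filter fun v => ((Y.filter fun w => G.Adj v w).card : ℝ) ≤ γ * m,
    Finset.filter_subset _ _, ?_, fun v hv => ?_⟩
  · rw [card_interedges_eq_sum] at he
    push_cast at he
    have h₁ := card_filter_not_le_mul_le X (fun v => (Y.filter fun w => G.Adj v w).card)
      (τ := γ * m) he
    have h₂ := le_of_mul_le_mul_right h₁ (by linarith)
    have h₃ := Finset.card_filter_add_card_filter_not (s := X)
      (fun v => ((Y.filter fun w => G.Adj v w).card : ℝ) ≤ γ * m)
    have h₄ : ((X.filter fun v => ((Y.filter fun w => G.Adj v w).card : ℝ) ≤ γ * m).card : ℝ) +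
        (X.filter fun v => ¬ ((Y.filter fun w => G.Adj v w).card : ℝ) ≤ γ * m).card = X.card := by
      exact_mod_cast h₃
    linarith
  · have hY := (Finset.mem_filter.1 hv).2
    have h₁ : G.degree v ≤ (X.filter fun w => G.Adj v w).card +
        (Y.filter fun w => G.Adj v w).card + (Z.filter fun w => G.Adj v w).card := by
      rw [← SimpleGraph.card_neighborFinset_eq_degree, SimpleGraph.neighborFinset_eq_filter,
        ← hcov, Finset.filter_union, Finset.filter_union]
      exact (Finset.card_union_le _ _).trans (Nat.add_le_add_right (Finset.card_union_le _ _) _)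
    have h₂ : (G.degree v : ℝ) ≤ (X.filter fun w => G.Adj v w).card +
        (Y.filter fun w => G.Adj v w).card + (Z.filter fun w => G.Adj v w).card := by
      exact_mod_cast h₁
    have h₃ : ((X.filter fun w => G.Adj v w).card : ℝ) + (X.filter fun w => ¬ G.Adj v w).card =
        X.card := by exact_mod_cast Finset.card_filter_add_card_filter_not _
    have h₄ : ((Z.filter fun w => G.Adj v w).card : ℝ) + (Z.filter fun w => ¬ G.Adj v w).card =
        Z.card := by exact_mod_cast Finset.card_filter_add_card_filter_not _
    have h₅ := hdeg v
    have h₆ : (0 : ℝ) ≤ (X.filter fun w => ¬ G.Adj v w).card := Nat.cast_nonneg _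
    have h₇ : (0 : ℝ) ≤ (Z.filter fun w => ¬ G.Adj v w).card := Nat.cast_nonneg _
    -- A vertex of degree at least `2m/3 - 1` with at most `γm` neighbours in `Y` misses at most
    -- `7γm + 1 ≤ 8γm` vertices of `X ∪ Z`.
    constructor <;> linarith

/-- Removing few vertices from the three parts of a special graph of large minimum degree leaves
three classes such that all edges between compatible classes are present, up to a small defect at
each vertex. -/
theorem exists_typical_classes {m : ℕ} {γ κ : ℝ} (hG : IsGammaSpecial γ m G)
    (hdeg : 2 * m / 3 ≤ G.minDegree) (hγ : 0 < γ) (hγ' : γ ≤ 1 / 50) (hκ : 0 < κ)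
    (hm : 1 ≤ γ * m) (h₁ : 8 * γ ≤ κ) (h₂ : 8 * γ ≤ κ * κ) :
    ∃ A : Fin 3 → Finset V, (∀ i j, i ≠ j → Disjoint (A i) (A j)) ∧
      (∀ i j, CompatibleClasses i j → ∀ v ∈ A i,
        (((A j).filter fun w => ¬ G.Adj v w).card : ℝ) ≤ κ * m) ∧
      (∀ i, m / 3 - 3 * κ * m ≤ (A i).card ∧ ((A i).card : ℝ) ≤ m / 3 + κ * m) ∧
      m + 1 - 4 * κ * m ≤ ((A 0).card : ℝ) + (A 1).card + (A 2).card := by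
  classical
  obtain ⟨hcard, X₁, X₂, X₃, d₁₂, d₁₃, d₂₃, hcov, hsize, he⟩ := hG
  simp only [List.mem_cons, List.not_mem_nil, or_false, forall_eq_or_imp, forall_eq] at hsize
  obtain ⟨⟨l₁, u₁⟩, ⟨l₂, u₂⟩, ⟨l₃, u₃⟩⟩ := hsize
  have hm0 : (0 : ℝ) < m := by
    by_contra h
    have : (m : ℝ) = 0 := le_antisymm (not_lt.1 h) (Nat.cast_nonneg _)
    rw [this] at hm
    linarith
  have hγm : 3 * γ * m ≤ 3 / 50 * m := by nlinarith
  have hdeg' : ∀ v, 2 * (m : ℝ) / 3 - 1 ≤ G.degree v := by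
    intro v
    have h := hdeg.trans (G.minDegree_le_degree v)
    have h' : 2 * m ≤ 3 * G.degree v + 3 := by omega
    have h'' : 2 * (m : ℝ) ≤ 3 * G.degree v + 3 := by exact_mod_cast h'
    linarith
  have he' : ((G.interedges X₁ X₂).card : ℝ) ≤ γ * m * (γ * m) := by
    refine he.trans ?_
    have e₁ : γ ^ 10 ≤ γ ^ 2 := pow_le_pow_of_le_one hγ.le (by linarith) (by norm_num)
    have e₂ : (X₁.card : ℝ) * X₂.card ≤ m * m := by
      exact mul_le_mul (by linarith) (by linarith) (Nat.cast_nonneg _) hm0.le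
    calc γ ^ 10 * ((X₁.card : ℝ) * X₂.card) ≤ γ ^ 2 * (m * m) := by gcongr
      _ = _ := by ring
  have he'' : ((G.interedges X₂ X₁).card : ℝ) ≤ γ * m * (γ * m) := by
    have : Std.Symm G.Adj := ⟨fun _ _ h => h.symm⟩
    rwa [show (G.interedges X₂ X₁).card = (G.interedges X₁ X₂).card from
      Rel.card_interedges_comm X₂ X₁]
  obtain ⟨A, hA, hAc, hAd⟩ := exists_typical_of_sparse hcov hm u₁ u₃ hdeg' he'
  obtain ⟨B, hB, hBc, hBd⟩ := exists_typical_of_sparse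
    (by rwa [Finset.union_comm X₂ X₁]) hm u₂ u₃ hdeg' he''
  have hκm : 8 * γ * m ≤ κ * m := by gcongr
  set C := X₃.filter fun w => ((A.filter fun v => ¬ G.Adj w v).card : ℝ) ≤ κ * m ∧
    ((B.filter fun v => ¬ G.Adj w v).card : ℝ) ≤ κ * m with hC
  have hcA := Finset.card_le_card hA
  have hcB := Finset.card_le_card hB
  have hcA' : (A.card : ℝ) ≤ X₁.card := by exact_mod_cast hcA
  have hcB' : (B.card : ℝ) ≤ X₂.card := by exact_mod_cast hcB
  -- At most `8γm²` pairs are missing, and `8γ ≤ κ²`, so at most `κm` vertices of `X₃` miss more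
  -- than `κm` vertices of `D`.
  have hlost : ∀ D : Finset V, (D.card : ℝ) ≤ m →
      (∀ v ∈ D, ((X₃.filter fun w => ¬ G.Adj v w).card : ℝ) ≤ 8 * γ * m) →
      ((X₃.filter fun w => ¬ ((D.filter fun v => ¬ G.Adj w v).card : ℝ) ≤ κ * m).card : ℝ) ≤
        κ * m := by
    intro D hD hDd
    have e₁ := card_atypical_mul_le (κ := κ * m) hDd
    refine le_of_mul_le_mul_right (e₁.trans ?_) (by positivity : 0 < κ * m)
    calc (D.card : ℝ) * (8 * γ * m) ≤ m * (8 * γ * m) := by gcongr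
      _ = 8 * γ * (m * m) := by ring
      _ ≤ κ * κ * (m * m) := by gcongr
      _ = κ * m * (κ * m) := by ring
  have hlA := hlost A (by linarith) fun v hv => (hAd v hv).2
  have hlB := hlost B (by linarith) fun v hv => (hBd v hv).2
  have hCc : (X₃.card : ℝ) ≤ C.card + κ * m + κ * m := by
    have hsub : X₃ ⊆ C ∪ (X₃.filter fun w =>
          ¬ ((A.filter fun v => ¬ G.Adj w v).card : ℝ) ≤ κ * m) ∪
        (X₃.filter fun w => ¬ ((B.filter fun v => ¬ G.Adj w v).card : ℝ) ≤ κ * m) := by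
      intro w hw
      simp only [hC, Finset.mem_union, Finset.mem_filter, hw, true_and]
      tauto
    have e₁ := (Finset.card_le_card hsub).trans ((Finset.card_union_le _ _).trans
      (Nat.add_le_add_right (Finset.card_union_le _ _) _))
    have e₂ : (X₃.card : ℝ) ≤ C.card +
        (X₃.filter fun w => ¬ ((A.filter fun v => ¬ G.Adj w v).card : ℝ) ≤ κ * m).card +
        (X₃.filter fun w => ¬ ((B.filter fun v => ¬ G.Adj w v).card : ℝ) ≤ κ * m).card := by
      exact_mod_cast e₁
    linarith
  have hCX : C ⊆ X₃ := Finset.filter_subset _ _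
  have hcC : (C.card : ℝ) ≤ X₃.card := by exact_mod_cast Finset.card_le_card hCX
  have hmono : ∀ {Y Y' : Finset V} (v : V), Y ⊆ Y' →
      ((Y'.filter fun w => ¬ G.Adj v w).card : ℝ) ≤ 8 * γ * m →
      ((Y.filter fun w => ¬ G.Adj v w).card : ℝ) ≤ κ * m := by
    intro Y Y' v hY h
    have : ((Y.filter fun w => ¬ G.Adj v w).card : ℝ) ≤
        (Y'.filter fun w => ¬ G.Adj v w).card := by
      exact_mod_cast Finset.card_le_card (Finset.filter_subset_filter _ hY)
    linarith
  have htot : (X₁.card : ℝ) + X₂.card + X₃.card = m + 1 := by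
    have e₁ : (X₁ ∪ X₂ ∪ X₃).card = X₁.card + X₂.card + X₃.card := by
      rw [Finset.card_union_of_disjoint (Finset.disjoint_union_left.2 ⟨d₁₃, d₂₃⟩),
        Finset.card_union_of_disjoint d₁₂]
    rw [hcov, Finset.card_univ, hcard] at e₁
    exact_mod_cast e₁.symm
  have hAB : Disjoint A B := d₁₂.mono hA hB
  have hAC : Disjoint A C := d₁₃.mono hA hCX
  have hBC : Disjoint B C := d₂₃.mono hB hCX
  refine ⟨![A, B, C], ?_, ?_, ?_, ?_⟩
  · intro i j hij
    fin_cases i <;> fin_cases j <;> first | exact absurd rfl hij | skip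
    · exact hAB
    · exact hAC
    · exact hAB.symm
    · exact hBC
    · exact hAC.symm
    · exact hBC.symm
  · intro i j hij v hv
    fin_cases i <;> fin_cases j <;> first | exact absurd hij (by decide) | skip
    · exact hmono v hA (hAd v hv).1
    · exact hmono v hCX (hAd v hv).2
    · exact hmono v hB (hBd v hv).1
    · exact hmono v hCX (hBd v hv).2
    · exact (Finset.mem_filter.1 hv).2.1
    · exact (Finset.mem_filter.1 hv).2.2
  · intro i
    fin_cases i
    · exact ⟨by change _ ≤ (A.card : ℝ); linarith, by change (A.card : ℝ) ≤ _; linarith⟩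
    · exact ⟨by change _ ≤ (B.card : ℝ); linarith, by change (B.card : ℝ) ≤ _; linarith⟩
    · exact ⟨by change _ ≤ (C.card : ℝ); linarith, by change (C.card : ℝ) ≤ _; linarith⟩
  · change _ ≤ (A.card : ℝ) + B.card + C.card
    linarith

end Graph

/-! ### Greedy embedding -/

/-- Greedy embedding: a compatible assignment of the vertices to classes with enough room extends
to an embedding. -/
theorem IsEmbeddingOn.exists_extension {α V : Type*} [DecidableEq α] [DecidableEq V]
    {T : SimpleGraph α} {G : SimpleGraph V} [DecidableRel G.Adj] {F D : Finset α} {t : α}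
    {par : α → α} {dep : α → ℕ} {S : Finset V} {φ : α → V} (hR : IsRootedTree F t par dep)
    (htD : t ∈ D) (hFD : Disjoint F D)
    (hT : ∀ x ∈ F, ∀ y, T.Adj x y → y = par x ∨ (y ∈ F ∧ par y = x))
    (hφ : IsEmbeddingOn T G D S φ) {A A' : Fin 3 → Finset V} {k : ℕ} {f : α → Fin 3}
    (hA : ∀ i j, i ≠ j → Disjoint (A i) (A j)) (hAA' : ∀ i, A i ⊆ A' i)
    (hAS : ∀ i, Disjoint (A i) S) (hAφ : ∀ i, ∀ x ∈ D, φ x ∉ A i)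
    (hdef : ∀ i j, CompatibleClasses i j → ∀ v ∈ A' i,
      ((A j).filter fun w => ¬ G.Adj v w).card ≤ k)
    (hf : ∀ x ∈ F, CompatibleClasses (f x) (f (par x))) (hft : φ t ∈ A' (f t))
    (hroom : ∀ i, (F.filter fun x => f x = i).card + k ≤ (A i).card) :
    ∃ ψ : α → V, IsEmbeddingOn T G (D ∪ F) S ψ ∧ ∀ x ∈ D, ψ x = φ x := by
  suffices h : ∀ n, ∀ s ⊆ F, s.card = n → (∀ x ∈ s, par x ∈ insert t s) →
      ∃ ψ : α → V, IsEmbeddingOn T G (D ∪ s) S ψ ∧ (∀ x ∈ D, ψ x = φ x) ∧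
        ∀ x ∈ s, ψ x ∈ A (f x) by
    obtain ⟨ψ, h₁, h₂, -⟩ := h _ F subset_rfl rfl hR.par_mem
    exact ⟨ψ, h₁, h₂⟩
  intro n
  induction n with
  | zero =>
    intro s _ hs _
    rw [Finset.card_eq_zero] at hs
    subst hs
    exact ⟨φ, by simpa using hφ, fun _ _ => rfl, by simp⟩
  | succ n ih =>
    intro s hsF hs hpar
    -- A deepest vertex has no child in `s`, so its parent is the only neighbour already embedded
    -- when it is added last.
    obtain ⟨x, hx, hmax⟩ := Finset.exists_max_image s dep (Finset.card_pos.1 (by omega))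
    have hxF := hsF hx
    have hxD : x ∉ D := Finset.disjoint_left.1 hFD hxF
    have hpx : par x ≠ x := fun e => by
      have := hR.dep_eq x hxF
      rw [e] at this
      omega
    have hpar' : ∀ y ∈ s.erase x, par y ∈ insert t (s.erase x) := by
      intro y hy
      have hys := Finset.mem_of_mem_erase hy
      rcases Finset.mem_insert.1 (hpar y hys) with h | h
      · exact h ▸ Finset.mem_insert_self _ _
      · refine Finset.mem_insert_of_mem (Finset.mem_erase.2 ⟨fun e => ?_, h⟩)
        have h₁ := hR.dep_eq y (hsF hys)
        have h₂ := hmax y hys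
        rw [e] at h₁
        omega
    obtain ⟨ψ, hψ, hψφ, hψA⟩ := ih (s.erase x) ((Finset.erase_subset _ _).trans hsF)
      (by rw [Finset.card_erase_of_mem hx]; omega) hpar'
    -- The image of the root is already occupied and so not in `A`; this is why the defect bound is
    -- required for the larger sets `A'`.
    have hpA : ψ (par x) ∈ A' (f (par x)) := by
      rcases Finset.mem_insert.1 (hpar x hx) with h | h
      · rw [h, hψφ t htD]
        exact hft
      · exact hAA' _ (hψA _ (Finset.mem_erase.2 ⟨hpx, h⟩))
    have hcomp : CompatibleClasses (f (par x)) (f x) := by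
      have := hf x hxF
      revert this
      generalize f x = i
      generalize f (par x) = j
      revert i j
      decide
    obtain ⟨w, hw, hwadj, hwnew⟩ : ∃ w ∈ A (f x), G.Adj (ψ (par x)) w ∧
        w ∉ ((s.erase x).filter fun y => f y = f x).image ψ := by
      by_contra! hcon
      have hsub : A (f x) ⊆ ((A (f x)).filter fun w => ¬ G.Adj (ψ (par x)) w) ∪
          ((s.erase x).filter fun y => f y = f x).image ψ := by
        intro w hw
        by_cases hadj : G.Adj (ψ (par x)) w
        · exact Finset.mem_union_right _ (hcon w hw hadj)
        · exact Finset.mem_union_left _ (Finset.mem_filter.2 ⟨hw, hadj⟩)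
      have h₁ := (Finset.card_le_card hsub).trans (Finset.card_union_le _ _)
      have h₂ := hdef _ _ hcomp _ hpA
      have h₃ := Finset.card_image_le (s := (s.erase x).filter fun y => f y = f x) (f := ψ)
      have h₄ : ((s.erase x).filter fun y => f y = f x).card <
          (F.filter fun y => f y = f x).card := by
        refine Finset.card_lt_card ⟨Finset.filter_subset_filter _
          ((Finset.erase_subset _ _).trans hsF), fun h => ?_⟩
        have := h (Finset.mem_filter.2 ⟨hxF, rfl⟩)
        simp at this
      have h₅ := hroom (f x)
      omega
    have hwψ : ∀ y ∈ D ∪ s.erase x, ψ y ≠ w := by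
      rintro y hy rfl
      rcases Finset.mem_union.1 hy with hyD | hys
      · exact hAφ _ y hyD (hψφ y hyD ▸ hw)
      · by_cases hfy : f y = f x
        · exact hwnew (Finset.mem_image_of_mem _ (Finset.mem_filter.2 ⟨hys, hfy⟩))
        · exact Finset.disjoint_left.1 (hA _ _ hfy) (hψA y hys) hw
    have hunion : D ∪ s = insert x (D ∪ s.erase x) := by
      rw [← Finset.union_insert, Finset.insert_erase hx]
    have hxn : x ∉ D ∪ s.erase x := by simp [hxD]
    have hupd : ∀ y ∈ D ∪ s.erase x, Function.update ψ x w y = ψ y := fun y hy =>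
      Function.update_of_ne (by rintro rfl; exact hxn hy) _ _
    have hadj : ∀ y ∈ D ∪ s.erase x, T.Adj x y → G.Adj w (ψ y) := by
      intro y hy hxy
      rcases hT x hxF y hxy with rfl | ⟨hyF, hyx⟩
      · exact hwadj.symm
      · have hys : y ∈ s.erase x := (Finset.mem_union.1 hy).resolve_left
          (Finset.disjoint_left.1 hFD hyF)
        have h₁ := hR.dep_eq y hyF
        have h₂ := hmax y (Finset.mem_of_mem_erase hys)
        rw [hyx] at h₁
        omega
    refine ⟨Function.update ψ x w, ?_, fun y hy => ?_, fun y hy => ?_⟩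
    · rw [hunion]
      constructor
      · rw [Finset.coe_insert, Set.injOn_insert (by simpa using hxn)]
        refine ⟨hψ.injOn.congr fun y hy => (hupd y (Finset.mem_coe.1 hy)).symm, ?_⟩
        rintro ⟨y, hy, hyw⟩
        rw [hupd y (Finset.mem_coe.1 hy), Function.update_self] at hyw
        exact hwψ y (Finset.mem_coe.1 hy) hyw
      · intro y hy
        rcases Finset.mem_insert.1 hy with rfl | hy
        · rw [Function.update_self]
          exact Finset.disjoint_left.1 (hAS _) hw
        · rw [hupd y hy]
          exact hψ.avoids y hy
      · intro y hy z hz hyz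
        rcases Finset.mem_insert.1 hy with rfl | hy <;> rcases Finset.mem_insert.1 hz with rfl | hz
        · exact absurd hyz (T.irrefl)
        · rw [Function.update_self, hupd z hz]
          exact hadj z hz hyz
        · rw [Function.update_self, hupd y hy]
          exact (hadj y hy hyz.symm).symm
        · rw [hupd y hy, hupd z hz]
          exact hψ.map_adj y hy z hz hyz
    · rw [hupd y (Finset.mem_union_left _ hy), hψφ y hy]
    · by_cases hyx : y = x
      · subst hyx
        rwa [Function.update_self]
      · have hy' := Finset.mem_erase.2 ⟨hyx, hy⟩
        rw [hupd y (Finset.mem_union_right _ hy')]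
        exact hψA y hy'

/-! ### Choice of constants and conclusion -/

theorem lemma2p7 :
    ∃ (m₀ : ℕ) (β γ₀ γ₁ : ℝ),
      0 < β ∧ β ≤ 1 / 10 ^ 10 ∧ 0 < γ₀ ∧ γ₀ ≤ 1 / 50 ∧ 0 < γ₁ ∧ γ₁ ≤ 1 / 50 ∧
      ∀ m : ℕ, m₀ ≤ m →
      ∀ (V : Type*) [Fintype V] [DecidableEq V] (G : SimpleGraph V) [DecidableRel G.Adj],
        Fintype.card V = m + 1 → IsGammaSpecial γ₀ m G → 2 * m / 3 ≤ G.minDegree →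
      ∀ (α : Type*) [Fintype α] [DecidableEq α] (T : SimpleGraph α) [DecidableRel T.Adj],
        T.IsTree → T.edgeFinset.card = m →
        (∀ v : α, ({u | T.Adj v u ∧ T.degree u = 1} : Finset α).card ≤ β * m) →
      ∀ (U : Finset α) (t : α), IsNiceSubtree γ₁ m T U t →
      ∀ L : Finset α, L ⊆ U \ {t} →
      ∀ S : Finset V, S.card + ⌈(γ₁ / 2) ^ 4 * m⌉₊ ≤ L.card →
      -- for every large `W` outside `S`, an embedding `φ W` of `T* - L` with `t` mapped into `W`
      ∀ φ : Finset V → α → V,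
        (∀ W : Finset V, W ⊆ Finset.univ \ S → γ₀ * m ≤ W.card →
          IsEmbeddingOn T G (U \ L) S (φ W) ∧ φ W t ∈ W) →
      -- one of the given embeddings extends to an embedding of `T - L`
        ∃ W : Finset V, W ⊆ Finset.univ \ S ∧ γ₀ * m ≤ W.card ∧
          ∃ ψ : α → V, IsEmbeddingOn T G (Finset.univ \ L) S ψ ∧ ∀ x ∈ U \ L, ψ x = φ W x := by
  -- With `κ = 10⁻¹⁵` below, `γ₀ = 10⁻³²` gives `8γ₀ ≤ κ²`, and `γ₁ = 1/1000` gives `(γ₁/2)⁴ > 7κ`: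
  -- `4κm` for the deleted vertices and `κm` of room in each of three classes. The bound on `m`
  -- ensures `γ₀m ≥ 1`.
  refine ⟨10 ^ 32, 1 / 10 ^ 10, 1 / 10 ^ 32, 1 / 1000, by norm_num, le_rfl, by norm_num,
    by norm_num, by norm_num, by norm_num, ?_⟩
  intro m hm V _ _ G _ hV hG hdeg α _ _ T _ hT hTm hleaf U t hU L hL S hS φ hφ
  have hmr : (10 : ℝ) ^ 32 ≤ m := by exact_mod_cast hm
  obtain ⟨par, dep, hR, hpar, hadj⟩ := hU.exists_isRootedTree hT
  have hLU : L ⊆ U := hL.trans Finset.sdiff_subset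
  have htL : t ∉ L := fun h => by simpa using hL h
  have htD : t ∈ U \ L := Finset.mem_sdiff.2 ⟨hU.root_mem, htL⟩
  have hα : Fintype.card α = m + 1 := by rw [← hTm, hT.card_edgeFinset]
  have hFc : Uᶜ.card + U.card = m + 1 := by rw [← hα, Finset.card_compl_add_card]
  have hU1 : 1 ≤ U.card := Finset.card_pos.2 ⟨t, hU.root_mem⟩
  have hFr : (Uᶜ.card : ℝ) + U.card = m + 1 := by exact_mod_cast hFc
  have hUr := hU.card_le
  have hDc : ((U \ L).card : ℝ) + L.card = U.card := by
    exact_mod_cast Finset.card_sdiff_add_card_eq_card hLU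
  have hSr : (S.card : ℝ) + (1 / 1000 / 2) ^ 4 * m ≤ L.card := by
    have h₁ := Nat.le_ceil ((1 / 1000 / 2 : ℝ) ^ 4 * m)
    have h₂ : (S.card : ℝ) + ⌈(1 / 1000 / 2 : ℝ) ^ 4 * m⌉₊ ≤ L.card := by exact_mod_cast hS
    linarith
  obtain ⟨i₀, -, hi₀⟩ := hR.exists_compatible_classes (m := m)
    (le_trans (by norm_num) hm) (by linarith) (by omega) fun v _ => by
      refine le_trans ?_ (hleaf v)
      norm_cast
      refine Finset.card_le_card fun x hx => ?_
      obtain ⟨hxF, hxv, hxc⟩ := Finset.mem_filter.1 hx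
      refine Finset.mem_filter.2 ⟨Finset.mem_univ _, hxv ▸ (hpar x hxF).symm, ?_⟩
      rw [← T.card_neighborFinset_eq_degree, Finset.card_eq_one]
      refine ⟨par x, Finset.eq_singleton_iff_unique_mem.2
        ⟨(T.mem_neighborFinset _ _).2 (hpar x hxF), fun y hy => ?_⟩⟩
      rcases hadj x hxF y ((T.mem_neighborFinset _ _).1 hy) with h | ⟨h₁, h₂⟩
      · exact h
      · exact absurd h₂ (hxc y h₁)
  obtain ⟨A, hAd, hAdef, hAc, hAsum⟩ := exists_typical_classes (κ := 1 / 10 ^ 15) hG hdeg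
    (by norm_num) (by norm_num) (by norm_num) (by linarith) (by norm_num) (by norm_num)
  have hSc : (S.card : ℝ) ≤ m / 1000 := by
    have : (0 : ℝ) ≤ (U \ L).card := Nat.cast_nonneg _
    linarith
  -- The set `W` depends only on the root class `i₀`; the class sizes are supplied only once `φ_W`
  -- is known.
  have hW : A i₀ \ S ⊆ Finset.univ \ S :=
    Finset.sdiff_subset_sdiff (Finset.subset_univ _) subset_rfl
  have hWc : 1 / 10 ^ 32 * (m : ℝ) ≤ (A i₀ \ S).card := by
    have h₁ : ((A i₀).card : ℝ) ≤ (A i₀ \ S).card + S.card := by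
      have := Finset.le_card_sdiff S (A i₀)
      exact_mod_cast (by omega : (A i₀).card ≤ (A i₀ \ S).card + S.card)
    have := (hAc i₀).1
    linarith
  refine ⟨A i₀ \ S, hW, hWc, ?_⟩
  obtain ⟨hemb, htW⟩ := hφ _ hW hWc
  set χ := φ (A i₀ \ S)
  set X := S ∪ (U \ L).image χ with hX
  set k := ⌊1 / 10 ^ 15 * (m : ℝ)⌋₊ with hk
  have hkm : (k : ℝ) ≤ 1 / 10 ^ 15 * m := Nat.floor_le (by positivity)
  have hXc : (X.card : ℝ) ≤ S.card + (U \ L).card := by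
    exact_mod_cast (Finset.card_union_le _ _).trans (Nat.add_le_add_left Finset.card_image_le _)
  have hAX : ∀ i, ((A i \ X).card : ℝ) + (X ∩ A i).card = (A i).card := fun i => by
    rw [Finset.inter_comm]
    exact_mod_cast Finset.card_sdiff_add_card_inter (A i) X
  have hXA : ∀ i, ((X ∩ A i).card : ℝ) ≤ X.card := fun i => by
    exact_mod_cast Finset.card_le_card Finset.inter_subset_left
  have hXsum : ((X ∩ A 0).card : ℝ) + (X ∩ A 1).card + (X ∩ A 2).card ≤ X.card := by
    have h₀₁ : Disjoint (X ∩ A 0) (X ∩ A 1) :=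
      (hAd 0 1 (by decide)).mono Finset.inter_subset_right Finset.inter_subset_right
    have h₀₂ : Disjoint (X ∩ A 0 ∪ X ∩ A 1) (X ∩ A 2) := Finset.disjoint_union_left.2
      ⟨(hAd 0 2 (by decide)).mono Finset.inter_subset_right Finset.inter_subset_right,
        (hAd 1 2 (by decide)).mono Finset.inter_subset_right Finset.inter_subset_right⟩
    have := Finset.card_le_card (Finset.union_subset (Finset.union_subset
      (Finset.inter_subset_left (s₁ := X) (s₂ := A 0))
      (Finset.inter_subset_left (s₁ := X) (s₂ := A 1)))
      (Finset.inter_subset_left (s₁ := X) (s₂ := A 2)))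
    rw [Finset.card_union_of_disjoint h₀₂, Finset.card_union_of_disjoint h₀₁] at this
    exact_mod_cast this
  have hnn : ∀ i, (0 : ℝ) ≤ (X ∩ A i).card := fun i => Nat.cast_nonneg _
  have hlow : ∀ i, (m : ℝ) / 3 - m / 500 ≤ ((A i \ X).card - k : ℕ) ∧
      (((A i \ X).card - k : ℕ) : ℝ) ≤ m / 3 + m / 1000 ∧
      (((A i \ X).card - k : ℕ) : ℝ) = (A i \ X).card - k := by
    intro i
    have h₁ := hAX i
    have h₂ := hXA i
    have h₃ := hAc i
    have h₄ := hnn i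
    have h₅ : (0 : ℝ) ≤ k := Nat.cast_nonneg _
    have h₆ : (k : ℝ) ≤ (A i \ X).card := by linarith
    rw [Nat.cast_sub (by exact_mod_cast h₆)]
    exact ⟨by linarith, by linarith, rfl⟩
  -- The capacities are the unoccupied parts of the classes, each reduced by the greedy reserve `k`.
  obtain ⟨f, hft, hf, hf₀, hf₁, hf₂⟩ := hi₀ ((A 0 \ X).card - k) ((A 1 \ X).card - k)
    ((A 2 \ X).card - k) (hlow 0).1 (hlow 0).2.1 (hlow 1).1 (hlow 1).2.1 (by
      have : (Uᶜ.card : ℝ) ≤ ((A 0 \ X).card - k : ℕ) + ((A 1 \ X).card - k : ℕ) +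
          ((A 2 \ X).card - k : ℕ) := by
        rw [(hlow 0).2.2, (hlow 1).2.2, (hlow 2).2.2]
        linarith [hAX 0, hAX 1, hAX 2]
      exact_mod_cast this)
  have hkA : ∀ i, k ≤ (A i \ X).card := fun i => by
    have h₁ := (hlow i).1
    rw [(hlow i).2.2] at h₁
    have : (k : ℝ) ≤ (A i \ X).card := by linarith
    exact_mod_cast this
  obtain ⟨ψ, hψ, hψφ⟩ := hemb.exists_extension hR htD
    (Finset.disjoint_left.2 fun x hx hx' =>
      Finset.mem_compl.1 hx (Finset.mem_sdiff.1 hx').1)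
    hadj (A := fun i => A i \ X) (A' := A) (k := k) (f := f)
    (fun i j hij => (hAd i j hij).mono Finset.sdiff_subset Finset.sdiff_subset)
    (fun i => Finset.sdiff_subset)
    (fun i => Finset.disjoint_left.2 fun v hv hvS =>
      (Finset.mem_sdiff.1 hv).2 (Finset.mem_union_left _ hvS))
    (fun i x hx hxA => (Finset.mem_sdiff.1 hxA).2
      (Finset.mem_union_right _ (Finset.mem_image_of_mem _ hx)))
    (fun i j hij v hv => Nat.le_floor (le_trans (by
      exact_mod_cast Finset.card_le_card (Finset.filter_subset_filter _ Finset.sdiff_subset))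
      (hAdef i j hij v hv)))
    hf (hft ▸ (Finset.mem_sdiff.1 htW).1)
    (fun i => by
      have h₁ := hkA i
      fin_cases i
      · exact (Nat.add_le_add_right hf₀ k).trans (Nat.sub_add_cancel h₁).le
      · exact (Nat.add_le_add_right hf₁ k).trans (Nat.sub_add_cancel h₁).le
      · exact (Nat.add_le_add_right hf₂ k).trans (Nat.sub_add_cancel h₁).le)
  have hset : U \ L ∪ Uᶜ = Finset.univ \ L := by
    ext x
    have := @hLU x
    simp only [Finset.mem_union, Finset.mem_sdiff, Finset.mem_compl, Finset.mem_univ, true_and]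
    tauto
  exact ⟨ψ, hset ▸ hψ, hψφ⟩
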